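/- Let $\mathcal X$ be a finite set of colours, $\mu$ a probability measure on $\mathcal X$ with $\mu(a)>0$ for all $a\in\mathcal X$, and for every integer $n\ge 1$ let $p_n:\mathcal X\times\mathcal X\to[0,1]$ be symmetric. The coloured random graph $X$ on the vertex set $V=\{1,\dots,n\}$ is obtained by giving the vertices independent colours $X(v)$, $v\in V$, with law $\mu$ and, given the colours, joining any two distinct vertices $u,v$ by an edge independently of everything else with probability $p_n(X(u),X(v))$. Let $E\subset\{(u,v)\in V\times V: u<v\}$ be its edge set. Let $(a_n)$ be positive reals with $a_n\to 0$ and $na_n\to\infty$, and suppose that $a_n^{-1}p_n(a,b)\to C(a,b)$ for all $a,b\in\mathcal X$, where $C:\mathcal X\times\mathcal X\to[0,\infty)$ is symmetric. Define the empirical colour measure and the empirical pair measure by $$L^1=\frac1n\sum_{v\in V}\delta_{X(v)},\qquad L^2=\frac1{n^2a_n}\sum_{(u,v)\in E}\big[\delta_{(X(v),X(u))}+\delta_{(X(u),X(v))}\big].$$ Let $\mathcal M(\mathcal X)$ be the space of probability measures on $\mathcal X$ and $\tilde{\mathcal M}_*(\mathcal X\times\mathcal X)$ the space of finite symmetric measures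 on $\mathcal X\times\mathcal X$, both with the weak topology. For finite measures $\rho,\nu$ on a finite set $\mathcal Y$ let $H(\rho\,\|\,\nu)=\sum_{y\in\mathcal Y}\rho(y)\log\frac{\rho(y)}{\nu(y)}$ if $\rho\ll\nu$ (with $0\log\frac{0}{\,\cdot\,}=0$) and $H(\rho\,\|\,\nu)=\infty$ otherwise; write $\|\rho\|$ for the total mass of $\rho$, $C\omega\otimes\omega(a,b)=C(a,b)\omega(a)\omega(b)$, and $$\mathfrak H_C(\varpi\,\|\,\omega)=H(\varpi\,\|\,C\omega\otimes\omega)+\|C\omega\otimes\omega\|-\|\varpi\|.$$ Then, as $n\to\infty$, the pair $(L^1,L^2)$ satisfies a large deviation principle in $\mathcal M(\mathcal X)\times\tilde{\mathcal M}_*(\mathcal X\times\mathcal X)$ (i) with speed $a_nn^2$ and good rate function $I_1(\omega,\varpi)=\tfrac12\mathfrak H_C(\varpi\,\|\,\omega)$; (ii) with speed $n$ and good rate function $I_2$ given by $I_2(\omega,\varpi)=H(\omega\,\|\,\mu)$ if $\varpi=C\omega\otimes\omega$, and $I_2(\omega,\varpi)=\infty$ otherwise. Here $Y_n$ satisfies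 a large deviation principle with speed $r_n$ and good rate function $I$ if $I$ is a nonnegative, lower semicontinuous, $[0,\infty]$-valued function with compact level sets $\{I\le\alpha\}$, $\alpha\in\mathbb R$, such that $$\limsup_{n\to\infty}\tfrac1{r_n}\log\mathbb P\{Y_n\in F\}\le-\inf_F I,\qquad \liminf_{n\to\infty}\tfrac1{r_n}\log\mathbb P\{Y_n\in O\}\ge-\inf_O I$$ for all closed sets $F$ and open sets $O$. -/

import Mathlib

open MeasureTheory Filter Topology
open scoped ENNReal NNReal

noncomputable section

/-! # Large deviation principles -/

/-- A good rate function: nonnegative, lower semicontinuous, with compact level sets. -/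
structure IsGoodRateFunction {S : Type*} [TopologicalSpace S] (I : S → EReal) : Prop where
  nonneg : ∀ s, 0 ≤ I s
  lowerSemicontinuous : LowerSemicontinuous I
  isCompact_levelSet : ∀ α : ℝ, IsCompact {s | I s ≤ (α : EReal)}

/-- The random elements `Y n` of the space `S`, defined on the spaces `(Ω n, P n)`, satisfy as
`n → ∞` a large deviation principle with speed `r n` and good rate function `I`. -/
structure SatisfiesLDP {S : Type*} [TopologicalSpace S] {Ω : ℕ+ → Type*}
    [∀ n, MeasurableSpace (Ω n)] (P : ∀ n, Measure (Ω n)) (Y : ∀ n, Ω n → S)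
    (r : ℕ+ → ℝ) (I : S → EReal) : Prop where
  goodRate : IsGoodRateFunction I
  upperBound : ∀ F : Set S, IsClosed F →
    limsup (fun n => ENNReal.log (P n (Y n ⁻¹' F)) / (r n : EReal)) atTop ≤ -(⨅ s ∈ F, I s)
  lowerBound : ∀ O : Set S, IsOpen O →
    -(⨅ s ∈ O, I s) ≤ liminf (fun n => ENNReal.log (P n (Y n ⁻¹' O)) / (r n : EReal)) atTop

/-! # Coloured random graphs -/

/-- Simple graphs on `n` vertices, each vertex carrying a colour from `X`. -/
structure ColouredGraph (X : Type*) (n : ℕ) where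
  colour : Fin n → X
  graph : SimpleGraph (Fin n)

namespace ColouredGraph

variable {X : Type*} {n : ℕ}

/-- A coloured graph is a colouring together with a graph. -/
def equivProd (X : Type*) (n : ℕ) : ColouredGraph X n ≃ (Fin n → X) × SimpleGraph (Fin n) where
  toFun x := (x.colour, x.graph)
  invFun y := ⟨y.1, y.2⟩
  left_inv _ := rfl
  right_inv _ := rfl

open Classical in
instance [Fintype X] : Fintype (ColouredGraph X n) := Fintype.ofEquiv _ (equivProd X n).symm

instance : MeasurableSpace (ColouredGraph X n) := ⊤

instance : DiscreteMeasurableSpace (ColouredGraph X n) := ⟨fun _ => trivial⟩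

/-- The unordered pairs of distinct vertices, represented by the ordered pairs `u < v`. -/
def vertexPairs (n : ℕ) : Finset (Fin n × Fin n) := {e | e.1 < e.2}

open Classical in
/-- The edges of a coloured graph, as ordered pairs `u < v`. -/
def edges (x : ColouredGraph X n) : Finset (Fin n × Fin n) :=
  {e ∈ vertexPairs n | x.graph.Adj e.1 e.2}

variable [MeasurableSpace X]

open Classical in
/-- The probability of the coloured graph `x`: colours are i.i.d. with law `μ` and, given the
colours, distinct vertices `u`, `v` are joined independently with probability
`p (colour u) (colour v)`. -/
def weight (μ : ProbabilityMeasure X) (p : X → X → unitInterval) (x : ColouredGraph X n) : ℝ :=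
  (∏ v, (μ : Measure X).real {x.colour v}) *
    ∏ e ∈ vertexPairs n, if x.graph.Adj e.1 e.2 then (p (x.colour e.1) (x.colour e.2) : ℝ)
      else 1 - (p (x.colour e.1) (x.colour e.2) : ℝ)

/-- The law of the coloured random graph with `n` vertices, colour law `μ` and connection
probabilities `p`. -/
def law [Fintype X] (n : ℕ) (μ : ProbabilityMeasure X) (p : X → X → unitInterval) :
    Measure (ColouredGraph X n) :=
  ∑ x, ENNReal.ofReal (weight μ p x) • Measure.dirac x

theorem weight_nonneg (μ : ProbabilityMeasure X) (p : X → X → unitInterval)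
    (x : ColouredGraph X n) : 0 ≤ weight μ p x := by
  refine mul_nonneg (Finset.prod_nonneg fun _ _ => measureReal_nonneg)
    (Finset.prod_nonneg fun e _ => ?_)
  have h := (p (x.colour e.1) (x.colour e.2)).2
  split_ifs
  · exact h.1
  · linarith [h.2]

open Classical in
/-- Summing the edge probabilities over all graphs gives one. -/
theorem sum_graph_weight (q : Fin n × Fin n → ℝ) :
    ∑ G : SimpleGraph (Fin n), ∏ e ∈ vertexPairs n, (if G.Adj e.1 e.2 then q e else 1 - q e)
      = 1 := by
  have h1 : ∏ e ∈ vertexPairs n, (q e + (1 - q e)) = 1 :=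
    Finset.prod_eq_one fun e _ => by ring
  rw [Finset.prod_add] at h1
  refine Eq.trans ?_ h1
  refine Finset.sum_bij' (fun G _ => {e ∈ vertexPairs n | G.Adj e.1 e.2})
    (fun T _ => SimpleGraph.fromRel fun u v => (u, v) ∈ T) ?_ ?_ ?_ ?_ ?_
  · intro G _
    simp
  · intro T _
    simp
  · intro G _
    ext u v
    simp only [SimpleGraph.fromRel_adj, Finset.mem_filter, vertexPairs, Finset.mem_univ, true_and]
    constructor
    · rintro ⟨_, h | h⟩
      · exact h.2
      · exact h.2.symm
    · intro h
      refine ⟨h.ne, ?_⟩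
      rcases lt_or_gt_of_ne h.ne with h' | h'
      · exact Or.inl ⟨h', h⟩
      · exact Or.inr ⟨h', h.symm⟩
  · intro T hT
    have hT' : ∀ e ∈ T, e.1 < e.2 := fun e he => by
      simpa [vertexPairs] using Finset.mem_powerset.1 hT he
    ext ⟨u, v⟩
    simp only [SimpleGraph.fromRel_adj, Finset.mem_filter, vertexPairs, Finset.mem_univ, true_and]
    constructor
    · rintro ⟨h, _, h' | h'⟩
      · exact h'
      · exact absurd (hT' _ h') (not_lt.2 h.le)
    · intro h
      exact ⟨hT' _ h, (hT' _ h).ne, Or.inl h⟩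
  · intro G _
    rw [Finset.prod_ite, ← Finset.filter_not]

/-- The law of the coloured random graph is a probability measure. -/
instance [Fintype X] [MeasurableSingletonClass X] (μ : ProbabilityMeasure X)
    (p : X → X → unitInterval) : IsProbabilityMeasure (law n μ p) := ⟨by
  classical
  have h : ∑ x : ColouredGraph X n, weight μ p x = 1 := by
    have h2 (c : Fin n → X) : ∑ G : SimpleGraph (Fin n), weight μ p (ColouredGraph.mk c G)
        = ∏ v, (μ : Measure X).real {c v} := by
      simp only [weight]
      rw [← Finset.mul_sum]
      refine (congrArg _ ?_).trans (mul_one _)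
      convert sum_graph_weight fun e => (p (c e.1) (c e.2) : ℝ)
    have h3 : ∑ b, (μ : Measure X).real {b} = 1 := by
      rw [sum_measureReal_singleton]
      simp
    rw [← (equivProd X n).symm.sum_comp, Fintype.sum_prod_type]
    refine (Finset.sum_congr rfl fun c _ => h2 c).trans ?_
    have h4 := Finset.prod_univ_sum (fun _ : Fin n => (Finset.univ : Finset X))
      fun _ b => (μ : Measure X).real {b}
    rw [Fintype.piFinset_univ] at h4
    rw [← h4]
    simp only [h3, Finset.prod_const_one]
  simp only [law, Measure.finsetSum_apply, Measure.smul_apply, measure_univ, smul_eq_mul, mul_one]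
  rw [← ENNReal.ofReal_sum_of_nonneg fun x _ => weight_nonneg μ p x, h, ENNReal.ofReal_one]⟩

/-- The empirical colour measure `L¹ = n⁻¹ ∑_v δ_{X(v)}`. -/
def L1 {n : ℕ+} (x : ColouredGraph X n) : ProbabilityMeasure X :=
  ⟨((n : ℕ) : ℝ≥0∞)⁻¹ • ∑ v, Measure.dirac (x.colour v), ⟨by
    have h0 : ((n : ℕ) : ℝ≥0∞) ≠ 0 := by exact_mod_cast n.ne_zero
    simp [Measure.finsetSum_apply, ENNReal.inv_mul_cancel h0 (ENNReal.natCast_ne_top _)]⟩⟩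

end ColouredGraph

/-- The finite symmetric measures on `X × X`, with the weak topology. -/
abbrev SymmetricFiniteMeasure (X : Type*) [MeasurableSpace X] : Type _ :=
  {ν : FiniteMeasure (X × X) // ν.map Prod.swap = ν}

/-- The measure `(n² a)⁻¹ ∑_{(u,v) ∈ E} (δ_{(X(v),X(u))} + δ_{(X(u),X(v))})`. -/
def ColouredGraph.pairMeasure {X : Type*} [MeasurableSpace X] {n : ℕ} (a : ℝ)
    (x : ColouredGraph X n) : Measure (X × X) :=
  ENNReal.ofReal (1 / ((n : ℝ) ^ 2 * a)) • ∑ e ∈ x.edges,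
    (Measure.dirac (x.colour e.2, x.colour e.1) + Measure.dirac (x.colour e.1, x.colour e.2))

instance {X : Type*} [MeasurableSpace X] {n : ℕ} (a : ℝ) (x : ColouredGraph X n) :
    IsFiniteMeasure (x.pairMeasure a) := ⟨by
  simp only [ColouredGraph.pairMeasure, Measure.smul_apply, Measure.finsetSum_apply,
    Measure.add_apply, measure_univ, smul_eq_mul]
  exact ENNReal.mul_lt_top ENNReal.ofReal_lt_top (by simp)⟩

theorem ColouredGraph.map_swap_pairMeasure {X : Type*} [MeasurableSpace X] {n : ℕ} (a : ℝ)
    (x : ColouredGraph X n) : (x.pairMeasure a).map Prod.swap = x.pairMeasure a := by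
  simp only [pairMeasure, Measure.map_smul]
  congr 1
  ext s hs
  rw [Measure.map_apply measurable_swap hs]
  simp only [Measure.finsetSum_apply, Measure.add_apply,
    Measure.dirac_apply' _ (measurable_swap hs), Measure.dirac_apply' _ hs]
  refine Finset.sum_congr rfl fun e _ => ?_
  rw [add_comm]
  rfl

/-- The empirical pair measure `L²` (where `a = a_n`), a finite symmetric measure. -/
def ColouredGraph.L2 {X : Type*} [MeasurableSpace X] {n : ℕ} (a : ℝ) (x : ColouredGraph X n) :
    SymmetricFiniteMeasure X :=
  ⟨(⟨x.pairMeasure a, inferInstance⟩ : FiniteMeasure (X × X)), by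
    apply Subtype.ext
    exact x.map_swap_pairMeasure a⟩

/-! # Rate functions -/

open Classical in
/-- The relative entropy `H(μ ‖ ν) = ∑_y μ(y) log (μ(y) / ν(y))` of finite, not necessarily
normalised, measures on a finite space; it is `∞` unless `μ ≪ ν`. -/
def relEntropy {Y : Type*} [Fintype Y] [MeasurableSpace Y] (μ ν : Measure Y) : EReal :=
  if μ ≪ ν then ((∑ y, μ.real {y} * Real.log (μ.real {y} / ν.real {y}) : ℝ) : EReal) else ⊤

section Rates

variable {X : Type*} [Fintype X] [MeasurableSpace X]

/-- The measure `Cω ⊗ ω (a, b) = C(a, b) ω(a) ω(b)`. -/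
def tiltedProd (C : X → X → ℝ≥0) (ω : ProbabilityMeasure X) : Measure (X × X) :=
  ((ω : Measure X).prod (ω : Measure X)).withDensity fun z => (C z.1 z.2 : ℝ≥0∞)

/-- `𝔥_C(ϖ ‖ ω) = H(ϖ ‖ Cω ⊗ ω) + ‖Cω ⊗ ω‖ - ‖ϖ‖`. -/
def frakH (C : X → X → ℝ≥0) (ϖ : SymmetricFiniteMeasure X) (ω : ProbabilityMeasure X) : EReal :=
  relEntropy (ϖ.1 : Measure (X × X)) (tiltedProd C ω)
    + ((tiltedProd C ω).real Set.univ : EReal) - ((ϖ.1 : Measure (X × X)).real Set.univ : EReal)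

/-- The rate function on the scale `a_n n²`. -/
def rateI1 (C : X → X → ℝ≥0) (s : ProbabilityMeasure X × SymmetricFiniteMeasure X) : EReal :=
  ((1 / 2 : ℝ) : EReal) * frakH C s.2 s.1

open Classical in
/-- The rate function on the scale `n`. -/
def rateI2 (μ : ProbabilityMeasure X) (C : X → X → ℝ≥0)
    (s : ProbabilityMeasure X × SymmetricFiniteMeasure X) : EReal :=
  if (s.2.1 : Measure (X × X)) = tiltedProd C s.1 then
    relEntropy (s.1 : Measure X) (μ : Measure X) else ⊤

end Rates

end

noncomputable section

/-! # Large deviations from families of exponentially controlled functions -/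

/-! Both principles rest on changes of measure whose densities depend on the graph, up to uniform
errors, only through the empirical pair. Tilting the edge probabilities by `exp g` has density
exponent `a n * n ^ 2 * (edgeFunctional C g + o(1))` (`exists_weight_tilt_error`). Replacing the
colour law `μ` by `μ'` has exponent exactly `n * colourFunctional μ μ'` (`weight_colour_tilt_eq`).

Upper bounds: the tilted law has mass at most one, so large values of these functionals are
exponentially unlikely. By Legendre duality the supremum of the edge functionals is `rateI1`. Since
`n * a n → ∞`, the edge speed dominates `n`; at speed `n` every positive multiple of an edge
functional is therefore admissible. These multiples force the rate to be infinite unless `ϖ = Cω ⊗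
ω`, and the colour functionals supply `H(ω ‖ μ)`. `IsTailFamily` abstracts this situation; a
compactness argument extends the bounds to closed sets.

Lower bounds: `rateI2` vanishes only at the typical state, so the upper bound at speed `n` already
contains a law of large numbers for every such model (`eventually_half_le`). It is applied to a
tilted model whose typical state is close to the target point, and the two laws are then compared
(`eventually_exp_le_of_comparison`). At speed `a n * n ^ 2` changing the colour law costs only
`O(n)`, which is why `μ` is absent from `rateI1`. Points whose densities vanish somewhere are
reached by approximation. -/

theorem ENNReal.log_div_le_of_measureReal_le {Ω : Type*} [MeasurableSpace Ω] {m : Measure Ω}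
    [IsFiniteMeasure m] {A : Set Ω} {r c : ℝ} (hr : 0 < r) (h : m.real A ≤ Real.exp (r * c)) :
    ENNReal.log (m A) / (r : EReal) ≤ (c : EReal) := by
  have h1 : m A ≤ ENNReal.ofReal (Real.exp (r * c)) := by
    rw [← ofReal_measureReal]
    exact ENNReal.ofReal_le_ofReal h
  have h2 : ENNReal.log (m A) ≤ ((r * c : ℝ) : EReal) := by
    refine (ENNReal.log_le_log h1).trans ?_
    rw [ENNReal.log_ofReal_of_pos (Real.exp_pos _), Real.log_exp]
  rw [EReal.div_le_iff_le_mul (by exact_mod_cast hr) (EReal.coe_ne_top _)]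
  exact_mod_cast h2

theorem ENNReal.le_log_div_of_le_measureReal {Ω : Type*} [MeasurableSpace Ω] {m : Measure Ω}
    [IsFiniteMeasure m] {A : Set Ω} {r c : ℝ} (hr : 0 < r) (h : Real.exp (r * c) ≤ m.real A) :
    (c : EReal) ≤ ENNReal.log (m A) / (r : EReal) := by
  have h1 : ENNReal.ofReal (Real.exp (r * c)) ≤ m A := by
    rw [← ofReal_measureReal (μ := m) (s := A)]
    exact ENNReal.ofReal_le_ofReal h
  have h2 : ((r * c : ℝ) : EReal) ≤ ENNReal.log (m A) := by
    refine le_trans ?_ (ENNReal.log_le_log h1)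
    rw [ENNReal.log_ofReal_of_pos (Real.exp_pos _), Real.log_exp]
  rw [EReal.le_div_iff_mul_le (by exact_mod_cast hr) (EReal.coe_ne_top _), mul_comm]
  exact_mod_cast h2

section Abstract

variable {S : Type*} {Ω : ℕ+ → Type*} [∀ n, MeasurableSpace (Ω n)]

/-- `P (Y n ∈ A)` is at most `exp (-r n (α - ε))` eventually, for every `ε > 0`. -/
def ExpSmall (P : ∀ n, Measure (Ω n)) (Y : ∀ n, Ω n → S) (r : ℕ+ → ℝ) (α : ℝ) (A : Set S) :
    Prop :=
  ∀ ε > 0, ∀ᶠ n in atTop, (P n).real (Y n ⁻¹' A) ≤ Real.exp (-(r n * (α - ε)))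

/-- The family `𝓕` consists of continuous functions with exponentially small tails, and its
pointwise supremum is `I`. -/
structure IsTailFamily [TopologicalSpace S] (P : ∀ n, Measure (Ω n)) (Y : ∀ n, Ω n → S) (r : ℕ+ → ℝ)
    (I : S → EReal) (𝓕 : Set (S → ℝ)) : Prop where
  continuous : ∀ Φ ∈ 𝓕, Continuous Φ
  expSmall : ∀ Φ ∈ 𝓕, ∀ α : ℝ, ExpSmall P Y r α {s | α < Φ s}
  le : ∀ Φ ∈ 𝓕, ∀ s, (Φ s : EReal) ≤ I s
  exists_lt : ∀ s (α : ℝ), (α : EReal) < I s → ∃ Φ ∈ 𝓕, α < Φ s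
  zero_mem : (fun _ => 0) ∈ 𝓕
  exists_isCompact : ∃ Φ ∈ 𝓕, ∀ α : ℝ, IsCompact {s | Φ s ≤ α}

variable {P : ∀ n, Measure (Ω n)} {Y : ∀ n, Ω n → S}
  {r : ℕ+ → ℝ} {I : S → EReal} {𝓕 : Set (S → ℝ)}

theorem ExpSmall.mono [∀ n, IsProbabilityMeasure (P n)] {α : ℝ} {A B : Set S} (h : ExpSmall P Y r α B) (hAB : A ⊆ B) :
    ExpSmall P Y r α A := fun ε hε => by
  filter_upwards [h ε hε] with n hn
  exact (measureReal_mono (Set.preimage_mono hAB)).trans hn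

/-- The factor 2 of the union bound is absorbed by half of the slack `ε`, because the speed tends to
infinity. -/
theorem ExpSmall.union (hr : Tendsto r atTop atTop) {α : ℝ} {A B : Set S}
    (hA : ExpSmall P Y r α A) (hB : ExpSmall P Y r α B) : ExpSmall P Y r α (A ∪ B) :=
  fun ε hε => by
  filter_upwards [hA (ε / 2) (half_pos hε), hB (ε / 2) (half_pos hε),
    hr.eventually_ge_atTop (2 / ε)] with n h1 h2 h3
  have h4 : (2 : ℝ) ≤ Real.exp (r n * (ε / 2)) := by
    have h5 : 1 ≤ r n * (ε / 2) := by
      rw [div_le_iff₀ hε] at h3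
      linarith
    linarith [Real.add_one_le_exp (r n * (ε / 2))]
  calc (P n).real (Y n ⁻¹' (A ∪ B))
      ≤ (P n).real (Y n ⁻¹' A) + (P n).real (Y n ⁻¹' B) := measureReal_union_le _ _
    _ ≤ 2 * Real.exp (-(r n * (α - ε / 2))) := by linarith
    _ ≤ Real.exp (r n * (ε / 2)) * Real.exp (-(r n * (α - ε / 2))) := by gcongr
    _ = Real.exp (-(r n * (α - ε))) := by rw [← Real.exp_add]; ring_nf

theorem ExpSmall.empty (α : ℝ) : ExpSmall P Y r α ∅ := fun ε _ =>
  Eventually.of_forall fun n => by simpa using (Real.exp_pos _).le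

variable [TopologicalSpace S]

/-- A supremum of continuous functions is lower semicontinuous, and its level sets are closed
subsets of the compact level sets of a single member. -/
theorem IsTailFamily.isGoodRateFunction (h : IsTailFamily P Y r I 𝓕) : IsGoodRateFunction I := by
  have hlsc : LowerSemicontinuous I := by
    intro s y hy
    obtain ⟨α, h1, h2⟩ := EReal.lt_iff_exists_real_btwn.1 hy
    obtain ⟨Φ, hΦ, h3⟩ := h.exists_lt s α h2
    filter_upwards [(h.continuous Φ hΦ).continuousAt.eventually_const_lt h3] with t ht
    exact h1.trans ((EReal.coe_lt_coe_iff.2 ht).trans_le (h.le Φ hΦ t))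
  refine ⟨fun s => by simpa using h.le _ h.zero_mem s, hlsc, fun α => ?_⟩
  obtain ⟨Φ, hΦ, hK⟩ := h.exists_isCompact
  refine (hK α).of_isClosed_subset (hlsc.isClosed_preimage α) fun s hs => ?_
  exact EReal.coe_le_coe_iff.1 ((h.le Φ hΦ s).trans hs)

variable [∀ n, IsProbabilityMeasure (P n)]

/-- The member with compact level sets provides exponential tightness. On its level set, finitely
many open sets `{α < Ψ}` cover `F`. -/
theorem IsTailFamily.expSmall_of_isClosed (h : IsTailFamily P Y r I 𝓕)
    (hr : Tendsto r atTop atTop) {F : Set S} (hF : IsClosed F) {α : ℝ}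
    (hα : ∀ s ∈ F, (α : EReal) < I s) : ExpSmall P Y r α F := by
  obtain ⟨Φ, hΦ, hK⟩ := h.exists_isCompact
  have h1 : ExpSmall P Y r α (F ∩ {s | Φ s ≤ α}) := by
    refine ((hK α).inter_left hF).induction_on (p := ExpSmall P Y r α) (ExpSmall.empty α)
      (fun A B hAB hB => hB.mono hAB) (fun A B => ExpSmall.union hr) fun s hs => ?_
    obtain ⟨Ψ, hΨ, h2⟩ := h.exists_lt s α (hα s hs.1)
    exact ⟨_, mem_nhdsWithin_of_mem_nhds
      ((h.continuous Ψ hΨ).continuousAt.eventually_const_lt h2), h.expSmall Ψ hΨ α⟩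
  refine (h1.union hr (h.expSmall Φ hΦ α)).mono fun s hs => ?_
  by_cases h3 : Φ s ≤ α
  · exact Or.inl ⟨hs, h3⟩
  · exact Or.inr (not_le.1 h3)

/-- Closed sets on which the rate function is positive have asymptotic probability zero. -/
theorem IsTailFamily.tendsto_zero_of_isClosed (h : IsTailFamily P Y r I 𝓕)
    (hr : Tendsto r atTop atTop) {F : Set S} (hF : IsClosed F) (hpos : ∀ s ∈ F, 0 < I s) :
    Tendsto (fun n => (P n).real (Y n ⁻¹' F)) atTop (𝓝 0) := by
  have key : ∀ {A : Set S} {α : ℝ}, 0 < α → ExpSmall P Y r α A →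
      Tendsto (fun n => (P n).real (Y n ⁻¹' A)) atTop (𝓝 0) := by
    intro A α hα hA
    refine squeeze_zero' (Eventually.of_forall fun n => measureReal_nonneg)
      (hA (α / 2) (half_pos hα)) ?_
    refine Real.tendsto_exp_neg_atTop_nhds_zero.comp (hr.atTop_mul_const ?_)
    linarith
  obtain ⟨Φ, hΦ, hK⟩ := h.exists_isCompact
  have h1 : Tendsto (fun n => (P n).real (Y n ⁻¹' (F ∩ {s | Φ s ≤ 1}))) atTop (𝓝 0) := by
    refine ((hK 1).inter_left hF).induction_on
      (p := fun A => Tendsto (fun n => (P n).real (Y n ⁻¹' A)) atTop (𝓝 0)) (by simp)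
      (fun A B hAB hB => squeeze_zero (fun n => measureReal_nonneg)
        (fun n => measureReal_mono (Set.preimage_mono hAB)) hB)
      (fun A B hA hB => squeeze_zero (fun n => measureReal_nonneg)
        (fun n => measureReal_union_le _ _) (by have := hA.add hB; rwa [add_zero] at this)) fun s hs => ?_
    -- The level `α` may depend on `s`: compactness leaves finitely many levels, so no uniform gap
    -- is required.
    obtain ⟨α, h2, h3⟩ := EReal.lt_iff_exists_real_btwn.1 (hpos s hs.1)
    obtain ⟨Ψ, hΨ, h4⟩ := h.exists_lt s α h3
    exact ⟨_, mem_nhdsWithin_of_mem_nhds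
      ((h.continuous Ψ hΨ).continuousAt.eventually_const_lt h4),
      key (by exact_mod_cast h2) (h.expSmall Ψ hΨ α)⟩
  have h5 := key one_pos (h.expSmall Φ hΦ 1)
  refine squeeze_zero (fun n => measureReal_nonneg) (fun n => ?_) (by simpa using h1.add h5)
  refine (measureReal_mono ?_).trans (measureReal_union_le _ _)
  intro x hx
  by_cases h3 : Φ (Y n x) ≤ 1
  · exact Or.inl ⟨hx, h3⟩
  · exact Or.inr (not_le.1 h3)

/-- The large deviation principle, given a tail family and lower bounds at the points of finite
rate. -/
theorem IsTailFamily.satisfiesLDP (h : IsTailFamily P Y r I 𝓕) (hr0 : ∀ n, 0 < r n)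
    (hr : Tendsto r atTop atTop)
    (hlow : ∀ O : Set S, IsOpen O → ∀ s ∈ O, ∀ β : ℝ, I s < β →
      ∀ᶠ n in atTop, Real.exp (-(r n * β)) ≤ (P n).real (Y n ⁻¹' O)) :
    SatisfiesLDP P Y r I where
  goodRate := h.isGoodRateFunction
  upperBound F hF := by
    rw [EReal.le_neg]
    refine EReal.ge_of_forall_gt_iff_ge.1 fun α hα => ?_
    rw [EReal.le_neg, ← EReal.coe_neg]
    refine EReal.le_of_forall_lt_iff_le.1 fun β hβ => ?_
    have hβ' : -α < β := by exact_mod_cast hβ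
    -- With slack `β + α` the exponent `-(r n * (α - (β + α)))` is `r n * β`.
    have h1 := h.expSmall_of_isClosed hr hF (α := α)
      (fun s hs => hα.trans_le (iInf₂_le s hs)) (β + α) (by linarith)
    refine limsup_le_of_le (by isBoundedDefault) ?_
    filter_upwards [h1] with n hn
    refine ENNReal.log_div_le_of_measureReal_le (hr0 n) (hn.trans_eq ?_)
    ring_nf
  lowerBound O hO := by
    rw [EReal.neg_le]
    refine le_iInf₂ fun s hs => ?_
    refine EReal.le_of_forall_lt_iff_le.1 fun β hβ => ?_
    rw [EReal.neg_le, ← EReal.coe_neg]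
    refine le_liminf_of_le (by isBoundedDefault) ?_
    filter_upwards [hlow O hO s hs β hβ] with n hn
    refine ENNReal.le_log_div_of_le_measureReal (hr0 n) (le_trans (le_of_eq ?_) hn)
    ring_nf

end Abstract

/-! # The weak topology on measures on finite spaces -/

section WeakTopology

theorem integral_eq_sum_measureReal {Y : Type*} [Fintype Y] [MeasurableSpace Y]
    [MeasurableSingletonClass Y] (ν : Measure Y) [IsFiniteMeasure ν] (f : Y → ℝ) :
    ∫ y, f y ∂ν = ∑ y, ν.real {y} * f y := by
  rw [integral_fintype Integrable.of_finite]
  simp only [smul_eq_mul]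

variable {Y : Type*} [Fintype Y] [TopologicalSpace Y] [DiscreteTopology Y] [MeasurableSpace Y]
  [BorelSpace Y]

theorem MeasureTheory.FiniteMeasure.continuous_measureReal_singleton (y : Y) :
    Continuous fun ν : FiniteMeasure Y => (ν : Measure Y).real {y} := by
  have h := FiniteMeasure.continuous_integral_continuousMap (X := Y)
    (⟨Set.indicator {y} 1, continuous_of_discreteTopology⟩ : C(Y, ℝ))
  simpa [integral_indicator_one] using h

theorem MeasureTheory.ProbabilityMeasure.continuous_measureReal_singleton (y : Y) :
    Continuous fun ν : ProbabilityMeasure Y => (ν : Measure Y).real {y} :=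
  (FiniteMeasure.continuous_measureReal_singleton y).comp
    ProbabilityMeasure.toFiniteMeasure_continuous

theorem MeasureTheory.FiniteMeasure.tendsto_of_tendsto_measureReal_singleton {ι : Type*}
    {l : Filter ι} {νs : ι → FiniteMeasure Y} {ν : FiniteMeasure Y}
    (h : ∀ y, Tendsto (fun i => (νs i : Measure Y).real {y}) l (𝓝 ((ν : Measure Y).real {y}))) :
    Tendsto νs l (𝓝 ν) := by
  refine FiniteMeasure.tendsto_iff_forall_integral_tendsto.2 fun f => ?_
  simp only [integral_eq_sum_measureReal]
  exact tendsto_finsetSum _ fun y _ => (h y).mul_const _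

theorem MeasureTheory.ProbabilityMeasure.tendsto_of_tendsto_measureReal_singleton {ι : Type*}
    {l : Filter ι} {νs : ι → ProbabilityMeasure Y} {ν : ProbabilityMeasure Y}
    (h : ∀ y, Tendsto (fun i => (νs i : Measure Y).real {y}) l (𝓝 ((ν : Measure Y).real {y}))) :
    Tendsto νs l (𝓝 ν) := by
  refine ProbabilityMeasure.tendsto_iff_forall_integral_tendsto.2 fun f => ?_
  simp only [integral_eq_sum_measureReal]
  exact tendsto_finsetSum _ fun y _ => (h y).mul_const _

end WeakTopology

/-! ### Compactness and convergence in the state space -/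

section StateSpace

variable {X : Type*} [Fintype X] [TopologicalSpace X] [DiscreteTopology X] [MeasurableSpace X]
  [BorelSpace X]

/-- Finite measures of bounded mass on a compact space form a weakly compact set, and symmetry is a
closed condition. -/
theorem isCompact_setOf_measureReal_univ_le (R : ℝ) :
    IsCompact {s : ProbabilityMeasure X × SymmetricFiniteMeasure X |
      (s.2.1 : Measure (X × X)).real Set.univ ≤ R} := by
  rcases lt_or_ge R 0 with hR | hR
  · convert isCompact_empty
    ext s
    exact iff_of_false (not_le.2 (hR.trans_le measureReal_nonneg)) (Set.notMem_empty s)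
  have hcl : IsClosed {ν : FiniteMeasure (X × X) | ν.map Prod.swap = ν} :=
    isClosed_eq (FiniteMeasure.continuous_map continuous_swap) continuous_id
  have h1 := hcl.isClosedEmbedding_subtypeVal.isCompact_preimage
    (isCompact_setOfPred_finiteMeasure_le_of_compactSpace (E := X × X) ⟨R, hR⟩)
  refine ((isCompact_univ (X := ProbabilityMeasure X)).prod h1).of_isClosed_subset ?_ ?_
  · have h2 : Continuous fun s : ProbabilityMeasure X × SymmetricFiniteMeasure X =>
        ((s.2.1.mass : ℝ≥0) : ℝ) := by fun_prop
    exact isClosed_le h2 continuous_const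
  · intro s hs
    exact ⟨trivial, hs⟩

theorem tendsto_state {ι : Type*} {l : Filter ι}
    {f : ι → ProbabilityMeasure X × SymmetricFiniteMeasure X}
    {s : ProbabilityMeasure X × SymmetricFiniteMeasure X}
    (h1 : ∀ b, Tendsto (fun i => ((f i).1 : Measure X).real {b}) l
      (𝓝 ((s.1 : Measure X).real {b})))
    (h2 : ∀ z, Tendsto (fun i => ((f i).2.1 : Measure (X × X)).real {z}) l
      (𝓝 ((s.2.1 : Measure (X × X)).real {z}))) : Tendsto f l (𝓝 s) :=
  (ProbabilityMeasure.tendsto_of_tendsto_measureReal_singleton h1).prodMk_nhds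
    (tendsto_subtype_rng.2 (FiniteMeasure.tendsto_of_tendsto_measureReal_singleton h2))

end StateSpace

/-! ### Measures with prescribed point masses -/

section MeasureOfReal

variable {Y : Type*} [Fintype Y] [MeasurableSpace Y]

/-- The measure with the given masses of the points. -/
def pointMassMeasure (w : Y → ℝ) : Measure Y := ∑ y, ENNReal.ofReal (w y) • Measure.dirac y

instance (w : Y → ℝ) : IsFiniteMeasure (pointMassMeasure w) := ⟨by
  simp [pointMassMeasure, Measure.finsetSum_apply]⟩

theorem isProbabilityMeasure_pointMassMeasure {w : Y → ℝ} (hw : ∀ y, 0 ≤ w y)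
    (h : ∑ y, w y = 1) : IsProbabilityMeasure (pointMassMeasure w) := ⟨by
  simp [pointMassMeasure, Measure.finsetSum_apply,
    ← ENNReal.ofReal_sum_of_nonneg fun y _ => hw y, h]⟩

theorem measure_ext_real_singleton {ν ν' : Measure Y} [IsFiniteMeasure ν] [IsFiniteMeasure ν']
    (h : ∀ y, ν.real {y} = ν'.real {y}) : ν = ν' :=
  Measure.ext_of_singleton fun y => (measureReal_eq_measureReal_iff).1 (h y)

variable [MeasurableSingletonClass Y]

theorem pointMassMeasure_singleton (w : Y → ℝ) (y : Y) :
    pointMassMeasure w {y} = ENNReal.ofReal (w y) := by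
  classical
  rw [pointMassMeasure, Measure.finsetSum_apply, Finset.sum_eq_single y]
  · simp
  · intro z _ hz
    simp [hz]
  · simp

theorem pointMassMeasure_real_singleton {w : Y → ℝ} (hw : ∀ y, 0 ≤ w y) (y : Y) :
    (pointMassMeasure w).real {y} = w y := by
  rw [measureReal_def, pointMassMeasure_singleton, ENNReal.toReal_ofReal (hw y)]

end MeasureOfReal

/-! ### Point masses of symmetric measures and of `Cω ⊗ ω` -/

section TiltedProd

variable {X : Type*} [MeasurableSpace X] [MeasurableSingletonClass X]

theorem SymmetricFiniteMeasure.real_singleton_swap (ϖ : SymmetricFiniteMeasure X) (z : X × X) :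
    (ϖ.1 : Measure (X × X)).real {z.swap} = (ϖ.1 : Measure (X × X)).real {z} := by
  have h : (ϖ.1 : Measure (X × X)).map Prod.swap = ϖ.1 :=
    congrArg (fun ν : FiniteMeasure (X × X) => (ν : Measure (X × X))) ϖ.2
  conv_rhs => rw [← h]
  rw [map_measureReal_apply measurable_swap (measurableSet_singleton z)]
  congr 1
  ext y
  simp [Prod.swap_eq_iff_eq_swap]

variable [Fintype X]

theorem tiltedProd_real_singleton (C : X → X → ℝ≥0) (ω : ProbabilityMeasure X) (z : X × X) :
    (tiltedProd C ω).real {z}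
      = C z.1 z.2 * ((ω : Measure X).real {z.1} * (ω : Measure X).real {z.2}) := by
  rw [measureReal_def, tiltedProd, withDensity_apply _ (measurableSet_singleton z),
    lintegral_singleton, ← Set.singleton_prod_singleton (a := z.1) (b := z.2), Measure.prod_prod]
  simp [measureReal_def]

instance (C : X → X → ℝ≥0) (ω : ProbabilityMeasure X) : IsFiniteMeasure (tiltedProd C ω) := ⟨by
  rw [tiltedProd, withDensity_apply _ MeasurableSet.univ, lintegral_fintype]
  refine ENNReal.sum_lt_top.2 fun z _ => ENNReal.mul_lt_top ENNReal.coe_lt_top ?_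
  exact measure_lt_top _ _⟩

/-- The symmetric measure with the given masses of the points. -/
def symmetricPointMassMeasure (w : X × X → ℝ) (hsymm : ∀ z, w z.swap = w z) :
    SymmetricFiniteMeasure X :=
  ⟨⟨pointMassMeasure w, inferInstance⟩, by
    apply Subtype.ext
    refine Measure.ext_of_singleton fun z => ?_
    change Measure.map Prod.swap (pointMassMeasure w) {z} = pointMassMeasure w {z}
    rw [Measure.map_apply measurable_swap (measurableSet_singleton z)]
    have : (Prod.swap ⁻¹' {z} : Set (X × X)) = {z.swap} := by
      ext y
      simp [Prod.swap_eq_iff_eq_swap]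
    rw [this, pointMassMeasure_singleton, pointMassMeasure_singleton, hsymm]⟩

end TiltedProd

/-! # Exponential change of measure for coloured random graphs -/

namespace ColouredGraph

variable {X : Type*} {n : ℕ}

theorem tilt_normalization_pos (q : unitInterval) (t : ℝ) :
    0 < 1 - (q : ℝ) + q * Real.exp t := by
  rcases q.2.1.eq_or_lt with h | h
  · rw [← h]
    simp
  · have := mul_pos h (Real.exp_pos t)
    linarith [q.2.2]

/-- The connection probabilities `p` tilted by `exp g`. -/
def tilt (p : X → X → unitInterval) (g : X × X → ℝ) : X → X → unitInterval := fun b c =>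
  ⟨p b c * Real.exp (g (b, c)) / (1 - p b c + p b c * Real.exp (g (b, c))), by
    have h := tilt_normalization_pos (p b c) (g (b, c))
    refine ⟨div_nonneg (mul_nonneg (p b c).2.1 (Real.exp_pos _).le) h.le,
      (div_le_one h).2 ?_⟩
    linarith [(p b c).2.2]⟩

theorem coe_tilt (p : X → X → unitInterval) (g : X × X → ℝ) (b c : X) : (tilt p g b c : ℝ)
    = p b c * Real.exp (g (b, c)) / (1 - p b c + p b c * Real.exp (g (b, c))) := rfl

/-- The logarithm of the normalising factor of the edge law tilted by `exp g`, given the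
colours. -/
def logNormalization (p : X → X → unitInterval) (g : X × X → ℝ) (x : ColouredGraph X n) : ℝ :=
  ∑ e ∈ vertexPairs n, Real.log (1 - p (x.colour e.1) (x.colour e.2)
    + p (x.colour e.1) (x.colour e.2) * Real.exp (g (x.colour e.1, x.colour e.2)))

variable [MeasurableSpace X]

/-- With `Z = 1 - p + p * exp g`, a present edge changes its factor by `exp g / Z` and an absent one
by `1 / Z`. The product of the `Z` depends on the colours alone. -/
theorem weight_tilt (μ : ProbabilityMeasure X) (p : X → X → unitInterval) (g : X × X → ℝ)
    (x : ColouredGraph X n) :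
    weight μ (tilt p g) x = weight μ p x *
      Real.exp (∑ e ∈ x.edges, g (x.colour e.1, x.colour e.2) - logNormalization p g x) := by
  classical
  rw [weight, weight, mul_assoc, edges, logNormalization, Finset.sum_filter,
    ← Finset.sum_sub_distrib, Real.exp_sum, ← Finset.prod_mul_distrib]
  congr 1
  refine Finset.prod_congr rfl fun e _ => ?_
  have h := tilt_normalization_pos (p (x.colour e.1) (x.colour e.2))
    (g (x.colour e.1, x.colour e.2))
  rw [Real.exp_sub, Real.exp_log h]
  split_ifs
  · rw [coe_tilt, mul_div_assoc]
  · rw [coe_tilt, Real.exp_zero]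
    field_simp
    ring

theorem weight_colour_tilt (μ μ' : ProbabilityMeasure X)
    (hμ : ∀ c, 0 < (μ : Measure X).real {c}) (hμ' : ∀ c, 0 < (μ' : Measure X).real {c})
    (p : X → X → unitInterval) (x : ColouredGraph X n) :
    weight μ' p x = weight μ p x *
      Real.exp (∑ v, Real.log ((μ' : Measure X).real {x.colour v}
        / (μ : Measure X).real {x.colour v})) := by
  classical
  rw [weight, weight, mul_right_comm, Real.exp_sum, ← Finset.prod_mul_distrib]
  congr 1
  refine Finset.prod_congr rfl fun v _ => ?_
  rw [Real.exp_log (div_pos (hμ' _) (hμ _)), mul_div_cancel₀ _ (hμ _).ne']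

variable [Fintype X]

open Classical in
theorem law_real (μ : ProbabilityMeasure X) (p : X → X → unitInterval)
    (A : Set (ColouredGraph X n)) :
    (law n μ p).real A = ∑ x with x ∈ A, weight μ p x := by
  rw [measureReal_def, law, Measure.finsetSum_apply]
  have h (x : ColouredGraph X n) : (ENNReal.ofReal (weight μ p x) • Measure.dirac x) A
      = if x ∈ A then ENNReal.ofReal (weight μ p x) else 0 := by
    rw [Measure.smul_apply, Measure.dirac_apply' _ (MeasurableSet.of_discrete), smul_eq_mul]
    by_cases hx : x ∈ A <;> simp [hx]
  simp only [h]
  rw [← Finset.sum_filter, ← ENNReal.ofReal_sum_of_nonneg fun x _ => weight_nonneg μ p x,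
    ENNReal.toReal_ofReal (Finset.sum_nonneg fun x _ => weight_nonneg μ p x)]

/-- Comparison of two laws on a set on which the density is bounded. -/
theorem law_real_le_mul (μ μ' : ProbabilityMeasure X) (p p' : X → X → unitInterval)
    {A : Set (ColouredGraph X n)} {κ : ℝ}
    (h : ∀ x ∈ A, weight μ p x ≤ κ * weight μ' p' x) :
    (law n μ p).real A ≤ κ * (law n μ' p').real A := by
  classical
  rw [law_real, law_real, Finset.mul_sum]
  exact Finset.sum_le_sum fun x hx => h x (by simpa using hx)

end ColouredGraph

/-! # Densities of tilted coloured random graphs in terms of the empirical measures -/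

namespace ColouredGraph

section Scalar

/-- This is the derivative of `log` at 1. Writing the difference quotient as `dslope` avoids
dividing by `q i`, which may vanish. -/
theorem tendsto_mul_log_one_add {ι : Type*} {l : Filter ι} {u q : ι → ℝ} {c : ℝ} (t : ℝ)
    (hq : Tendsto q l (𝓝 0)) (huq : Tendsto (fun i => u i * q i) l (𝓝 c)) :
    Tendsto (fun i => u i * Real.log (1 - q i + q i * Real.exp t)) l
      (𝓝 (c * (Real.exp t - 1))) := by
  have h1 : ContinuousAt (dslope Real.log 1) 1 :=
    continuousAt_dslope_same.2 (Real.differentiableAt_log one_ne_zero)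
  have h2 : Tendsto (fun i => 1 - q i + q i * Real.exp t) l (𝓝 1) := by
    simpa using (hq.const_sub 1).add (hq.mul_const (Real.exp t))
  have h3 := (huq.mul_const (Real.exp t - 1)).mul (h1.tendsto.comp h2)
  rw [dslope_same, Real.deriv_log, inv_one, mul_one] at h3
  refine h3.congr fun i => ?_
  have h4 := sub_smul_dslope Real.log 1 (1 - q i + q i * Real.exp t)
  rw [Real.log_one, sub_zero, smul_eq_mul] at h4
  rw [← h4, Function.comp_apply]
  ring

/-- Edges live on pairs `u < v`, whereas the product of the empirical colour measure with itself
sees all ordered pairs; the diagonal is the discrepancy. -/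
theorem sum_prod_eq_two_mul_sum_vertexPairs {n : ℕ} (k : Fin n → Fin n → ℝ)
    (hk : ∀ u v, k u v = k v u) :
    ∑ u, ∑ v, k u v = 2 * ∑ e ∈ vertexPairs n, k e.1 e.2 + ∑ u, k u u := by
  have h1 : ∑ e ∈ vertexPairs n, k e.1 e.2 = ∑ u, ∑ v, if u < v then k u v else 0 := by
    rw [vertexPairs, Finset.sum_filter, ← Finset.univ_product_univ, Finset.sum_product]
  have h2 : ∑ e ∈ vertexPairs n, k e.1 e.2 = ∑ u, ∑ v, if v < u then k u v else 0 := by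
    rw [h1, Finset.sum_comm]
    exact Finset.sum_congr rfl fun u _ => Finset.sum_congr rfl fun v _ => by rw [hk]
  have h3 : ∑ u, k u u = ∑ u, ∑ v, if u = v then k u v else 0 := by simp
  rw [two_mul]
  nth_rewrite 1 [h1]
  rw [h2, h3, ← Finset.sum_add_distrib, ← Finset.sum_add_distrib]
  refine Finset.sum_congr rfl fun u _ => ?_
  rw [← Finset.sum_add_distrib, ← Finset.sum_add_distrib]
  refine Finset.sum_congr rfl fun v _ => ?_
  rcases lt_trichotomy u v with h | h | h
  · simp [h, h.ne, h.not_gt]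
  · simp [h]
  · simp [h, h.ne', h.not_gt]

end Scalar

section Connection

variable {X : Type*} {p : ℕ+ → X → X → unitInterval} {a : ℕ+ → ℝ} {C : X → X → ℝ≥0}

theorem tendsto_connection_zero (ha : ∀ n, 0 < a n) (ha_zero : Tendsto a atTop (𝓝 0))
    (hpC : ∀ b c, Tendsto (fun n => (a n)⁻¹ * (p n b c : ℝ)) atTop (𝓝 (C b c : ℝ))) (b c : X) :
    Tendsto (fun n => (p n b c : ℝ)) atTop (𝓝 0) := by
  have h := ha_zero.mul (hpC b c)
  rw [zero_mul] at h
  exact h.congr fun n => mul_inv_cancel_left₀ (ha n).ne' _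

theorem tendsto_tilt (ha : ∀ n, 0 < a n) (ha_zero : Tendsto a atTop (𝓝 0))
    (hpC : ∀ b c, Tendsto (fun n => (a n)⁻¹ * (p n b c : ℝ)) atTop (𝓝 (C b c : ℝ)))
    (g : X × X → ℝ) (b c : X) :
    Tendsto (fun n => (a n)⁻¹ * (tilt (p n) g b c : ℝ)) atTop
      (𝓝 (C b c * Real.exp (g (b, c)))) := by
  have h1 := tendsto_connection_zero ha ha_zero hpC b c
  have h2 := ((hpC b c).mul_const (Real.exp (g (b, c)))).div
    ((h1.const_sub 1).add (h1.mul_const (Real.exp (g (b, c))))) (by simp)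
  simp only [sub_zero, zero_mul, add_zero, div_one] at h2
  refine h2.congr fun n => ?_
  rw [coe_tilt, Pi.div_apply, mul_assoc, mul_div_assoc]

end Connection

variable {X : Type*} [Fintype X] [MeasurableSpace X] [MeasurableSingletonClass X]

theorem sum_L1 {n : ℕ+} (x : ColouredGraph X n) (f : X → ℝ) :
    ∑ b, (x.L1 : Measure X).real {b} * f b = (n : ℝ)⁻¹ * ∑ v, f (x.colour v) := by
  rw [← integral_eq_sum_measureReal]
  change ∫ b, f b ∂(((n : ℕ) : ℝ≥0∞)⁻¹ • ∑ v, Measure.dirac (x.colour v) : Measure X) = _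
  rw [integral_smul_measure, integral_finsetSum_measure fun _ _ => Integrable.of_finite]
  simp [integral_dirac]

/-- By symmetry of `g` the two atoms of each edge contribute equally. The resulting factor 2 is the
origin of the `1 / 2` in the rate. -/
theorem sum_L2 {n : ℕ} {a : ℝ} (ha : 0 < a) (x : ColouredGraph X n) (g : X × X → ℝ)
    (hg : ∀ z, g z.swap = g z) :
    ∑ z, ((x.L2 a).1 : Measure (X × X)).real {z} * g z
      = 1 / ((n : ℝ) ^ 2 * a) * (2 * ∑ e ∈ x.edges, g (x.colour e.1, x.colour e.2)) := by
  rw [← integral_eq_sum_measureReal]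
  change ∫ z, g z ∂(x.pairMeasure a) = _
  rw [pairMeasure, integral_smul_measure,
    integral_finsetSum_measure fun _ _ => Integrable.of_finite,
    ENNReal.toReal_ofReal (by positivity), smul_eq_mul]
  congr 1
  rw [Finset.mul_sum]
  refine Finset.sum_congr rfl fun e _ => ?_
  rw [integral_add_measure Integrable.of_finite Integrable.of_finite, integral_dirac,
    integral_dirac, ← hg (x.colour e.2, x.colour e.1), Prod.swap_prod_mk, two_mul]

theorem sum_tiltedProd_L1 {n : ℕ+} (x : ColouredGraph X n) (C : X → X → ℝ≥0) (k : X × X → ℝ) :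
    ∑ z, (tiltedProd C x.L1).real {z} * k z = ((n : ℝ) ^ 2)⁻¹ *
      ∑ u, ∑ v, C (x.colour u) (x.colour v) * k (x.colour u, x.colour v) := by
  have h1 : ∑ z, (tiltedProd C x.L1).real {z} * k z
      = ∑ b, (x.L1 : Measure X).real {b} * ∑ c, (x.L1 : Measure X).real {c} *
        (C b c * k (b, c)) := by
    rw [Fintype.sum_prod_type]
    refine Finset.sum_congr rfl fun b _ => ?_
    rw [Finset.mul_sum]
    refine Finset.sum_congr rfl fun c _ => ?_
    rw [tiltedProd_real_singleton]
    ring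
  rw [h1, sum_L1 x fun b => ∑ c, (x.L1 : Measure X).real {c} * (C b c * k (b, c))]
  have h2 (u : Fin n) := sum_L1 x fun c => (C (x.colour u) c : ℝ) * k (x.colour u, c)
  simp only [h2]
  rw [← Finset.mul_sum, ← mul_assoc]
  congr 1
  rw [sq, mul_inv]

/-- The density exponent, per vertex, of the colour law `μ'` with respect to `μ`. -/
def colourFunctional (μ μ' : ProbabilityMeasure X)
    (s : ProbabilityMeasure X × SymmetricFiniteMeasure X) : ℝ :=
  ∑ b, (s.1 : Measure X).real {b} *
    Real.log ((μ' : Measure X).real {b} / (μ : Measure X).real {b})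

/-- The limiting density exponent of the edges tilted by `exp g`. -/
def edgeFunctional (C : X → X → ℝ≥0) (g : X × X → ℝ)
    (s : ProbabilityMeasure X × SymmetricFiniteMeasure X) : ℝ :=
  1 / 2 * (∑ z, (s.2.1 : Measure (X × X)).real {z} * g z
    - ∑ z, (tiltedProd C s.1).real {z} * (Real.exp (g z) - 1))

theorem weight_colour_tilt_eq (μ μ' : ProbabilityMeasure X)
    (hμ : ∀ c, 0 < (μ : Measure X).real {c}) (hμ' : ∀ c, 0 < (μ' : Measure X).real {c})
    (p : X → X → unitInterval) {n : ℕ+} (a : ℝ) (x : ColouredGraph X n) :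
    weight μ' p x = weight μ p x * Real.exp (n * colourFunctional μ μ' (x.L1, x.L2 a)) := by
  rw [weight_colour_tilt μ μ' hμ hμ', colourFunctional, sum_L1 x fun b =>
    Real.log ((μ' : Measure X).real {b} / (μ : Measure X).real {b}), mul_inv_cancel_left₀]
  exact_mod_cast n.ne_zero

section Asymptotics

variable {p : ℕ+ → X → X → unitInterval} {a : ℕ+ → ℝ} {C : X → X → ℝ≥0}

/-- Given the colours, the normalising factor of the tilted edge law only depends on the empirical
colour measure, up to a uniformly small error. -/
theorem exists_logNormalization_error (hp : ∀ n b c, p n b c = p n c b) (ha : ∀ n, 0 < a n)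
    (ha_zero : Tendsto a atTop (𝓝 0)) (hC : ∀ b c, C b c = C c b)
    (hpC : ∀ b c, Tendsto (fun n => (a n)⁻¹ * (p n b c : ℝ)) atTop (𝓝 (C b c : ℝ)))
    {g : X × X → ℝ} (hg : ∀ z, g z.swap = g z) :
    ∃ ε : ℕ+ → ℝ, Tendsto ε atTop (𝓝 0) ∧ ∀ (n : ℕ+) (x : ColouredGraph X n),
      |a n * (n : ℝ) ^ 2 * (1 / 2 * ∑ z, (tiltedProd C x.L1).real {z} * (Real.exp (g z) - 1))
        - logNormalization (p n) g x| ≤ a n * (n : ℝ) ^ 2 * ε n := by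
  set k : X → X → ℝ := fun b c => C b c * (Real.exp (g (b, c)) - 1) with hk
  set L : ℕ+ → X → X → ℝ := fun n b c =>
    Real.log (1 - p n b c + p n b c * Real.exp (g (b, c))) with hL
  have hgs (b c : X) : g (b, c) = g (c, b) := hg (c, b)
  have hksymm (b c : X) : k b c = k c b := by simp only [hk, hC b c, hgs b c]
  have hLsymm (n : ℕ+) (b c : X) : L n b c = L n c b := by simp only [hL, hp n b c, hgs b c]
  -- The first term is the error in the limit of the rescaled logarithms, summed over the finitely
  -- many colour pairs. The second accounts for the `n` diagonal terms, negligible against `n ^ 2`.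
  refine ⟨fun n => 1 / 2 * ∑ b, ∑ c, |k b c - (a n)⁻¹ * L n b c|
    + 1 / 2 * (n : ℝ)⁻¹ * ∑ b, |(a n)⁻¹ * L n b b|, ?_, fun n x => ?_⟩
  · have hlim (b c : X) : Tendsto (fun n => (a n)⁻¹ * L n b c) atTop (𝓝 (k b c)) :=
      tendsto_mul_log_one_add _ (tendsto_connection_zero ha ha_zero hpC b c) (hpC b c)
    have h1 : Tendsto (fun n => 1 / 2 * ∑ b, ∑ c, |k b c - (a n)⁻¹ * L n b c|) atTop
        (𝓝 (1 / 2 * ∑ b, ∑ c, |k b c - k b c|)) :=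
      (tendsto_finsetSum _ fun b _ => tendsto_finsetSum _ fun c _ =>
        ((hlim b c).const_sub _).abs).const_mul _
    have h2 : Tendsto (fun n : ℕ+ => (n : ℝ)⁻¹) atTop (𝓝 0) :=
      tendsto_inv_atTop_zero.comp
        (tendsto_natCast_atTop_atTop.comp tendsto_PNat_val_atTop_atTop)
    have h3 : Tendsto (fun n => ∑ b, |(a n)⁻¹ * L n b b|) atTop (𝓝 (∑ b, |k b b|)) :=
      tendsto_finsetSum _ fun b _ => (hlim b b).abs
    have h4 := h1.add ((h2.const_mul (1 / 2)).mul h3)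
    simp only [sub_self, abs_zero, Finset.sum_const_zero, mul_zero, zero_mul, add_zero] at h4
    exact h4
  · have hn : (0 : ℝ) < n := by exact_mod_cast n.pos
    set D : Fin n → Fin n → ℝ := fun u v =>
      k (x.colour u) (x.colour v) - (a n)⁻¹ * L n (x.colour u) (x.colour v) with hD
    have hZ : logNormalization (p n) g x = 1 / 2 * (∑ u, ∑ v, L n (x.colour u) (x.colour v)
        - ∑ u, L n (x.colour u) (x.colour u)) := by
      rw [sum_prod_eq_two_mul_sum_vertexPairs (fun u v => L n (x.colour u) (x.colour v))
        fun u v => hLsymm n _ _]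
      simp only [logNormalization, hL]
      ring
    have hT : ∑ z, (tiltedProd C x.L1).real {z} * (Real.exp (g z) - 1)
        = ((n : ℝ) ^ 2)⁻¹ * ∑ u, ∑ v, k (x.colour u) (x.colour v) := by
      rw [sum_tiltedProd_L1]
    have hB1 : |∑ u, ∑ v, D u v| ≤ (n : ℝ) ^ 2 * ∑ b, ∑ c, |k b c - (a n)⁻¹ * L n b c| := by
      have h (u v : Fin n) : |D u v| ≤ ∑ b, ∑ c, |k b c - (a n)⁻¹ * L n b c| := by
        refine le_trans ?_ (Finset.single_le_sum (f := fun b => ∑ c, |k b c - (a n)⁻¹ * L n b c|)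
          (fun b _ => Finset.sum_nonneg fun c _ => abs_nonneg _) (Finset.mem_univ (x.colour u)))
        exact Finset.single_le_sum
          (f := fun c => |k (x.colour u) c - (a n)⁻¹ * L n (x.colour u) c|)
          (fun c _ => abs_nonneg _) (Finset.mem_univ (x.colour v))
      refine (Finset.abs_sum_le_sum_abs _ _).trans ((Finset.sum_le_sum fun u _ =>
        (Finset.abs_sum_le_sum_abs _ _).trans (Finset.sum_le_sum fun v _ => h u v)).trans_eq ?_)
      simp
      ring
    have hB2 : |∑ u, (a n)⁻¹ * L n (x.colour u) (x.colour u)|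
        ≤ n * ∑ b, |(a n)⁻¹ * L n b b| := by
      refine (Finset.abs_sum_le_sum_abs _ _).trans ((Finset.sum_le_sum fun u _ =>
        Finset.single_le_sum (f := fun b => |(a n)⁻¹ * L n b b|) (fun b _ => abs_nonneg _)
          (Finset.mem_univ (x.colour u))).trans_eq ?_)
      simp
    have hmain : a n * (n : ℝ) ^ 2 * (1 / 2 * ∑ z, (tiltedProd C x.L1).real {z} *
        (Real.exp (g z) - 1)) - logNormalization (p n) g x
        = a n * (1 / 2) * (∑ u, ∑ v, D u v
          + ∑ u, (a n)⁻¹ * L n (x.colour u) (x.colour u)) := by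
      rw [hT, hZ]
      simp only [hD, Finset.sum_sub_distrib, ← Finset.mul_sum]
      have := (ha n).ne'
      field_simp
      ring
    rw [hmain, abs_mul, abs_of_pos (by have := ha n; positivity : 0 < a n * (1 / 2))]
    calc _ ≤ a n * (1 / 2) * ((n : ℝ) ^ 2 * ∑ b, ∑ c, |k b c - (a n)⁻¹ * L n b c|
          + n * ∑ b, |(a n)⁻¹ * L n b b|) := by
          refine mul_le_mul_of_nonneg_left ((abs_add_le _ _).trans (add_le_add hB1 hB2)) ?_
          have := ha n
          positivity
      _ = _ := by
          field_simp

/-- Up to a uniformly small error, the density of the law with connection probabilities tilted by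
`exp g` is the exponential of `edgeFunctional C g`, on the scale `a n * n ^ 2`. -/
theorem exists_weight_tilt_error (hp : ∀ n b c, p n b c = p n c b) (ha : ∀ n, 0 < a n)
    (ha_zero : Tendsto a atTop (𝓝 0)) (hC : ∀ b c, C b c = C c b)
    (hpC : ∀ b c, Tendsto (fun n => (a n)⁻¹ * (p n b c : ℝ)) atTop (𝓝 (C b c : ℝ)))
    {g : X × X → ℝ} (hg : ∀ z, g z.swap = g z) :
    ∃ ε : ℕ+ → ℝ, Tendsto ε atTop (𝓝 0) ∧ ∀ (μ : ProbabilityMeasure X) (n : ℕ+)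
      (x : ColouredGraph X n), ∃ η : ℝ, |η| ≤ ε n ∧ weight μ (tilt (p n) g) x = weight μ (p n) x *
        Real.exp (a n * (n : ℝ) ^ 2 * (edgeFunctional C g (x.L1, x.L2 (a n)) + η)) := by
  obtain ⟨ε, hε, h⟩ := exists_logNormalization_error hp ha ha_zero hC hpC hg
  refine ⟨ε, hε, fun μ n x => ?_⟩
  have hn : (0 : ℝ) < n := by exact_mod_cast n.pos
  have hr : 0 < a n * (n : ℝ) ^ 2 := mul_pos (ha n) (by positivity)
  set T := a n * (n : ℝ) ^ 2 *
    (1 / 2 * ∑ z, (tiltedProd C x.L1).real {z} * (Real.exp (g z) - 1)) with hT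
  refine ⟨(T - logNormalization (p n) g x) / (a n * (n : ℝ) ^ 2), ?_, ?_⟩
  · rw [abs_div, abs_of_pos hr, div_le_iff₀ hr, mul_comm]
    exact h n x
  · rw [weight_tilt]
    congr 2
    rw [edgeFunctional, sum_L2 (ha n) x g hg, mul_add, mul_div_cancel₀ _ hr.ne', hT]
    have := (ha n).ne'
    field_simp
    ring

end Asymptotics

end ColouredGraph

/-! # Variational formulas for the relative entropy on finite spaces -/

section ScalarEntropy

/-- Young's inequality: the right side is the convex conjugate of `t ↦ m * (exp t - 1)` at `x`. For
positive `x` and `m` it is `log y ≤ y - 1` at `y = m * exp t / x`. -/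
theorem mul_sub_mul_exp_sub_one_le {x m : ℝ} (hx : 0 ≤ x) (hm : 0 ≤ m) (h : m = 0 → x = 0)
    (t : ℝ) : x * t - m * (Real.exp t - 1) ≤ x * Real.log (x / m) + m - x := by
  rcases hm.eq_or_lt with rfl | hm
  · simp [h rfl]
  rcases hx.eq_or_lt with rfl | hx
  · have := mul_pos hm (Real.exp_pos t)
    simp only [zero_mul, zero_sub, zero_add, sub_zero]
    linarith
  · have h1 := Real.log_le_sub_one_of_pos (div_pos (mul_pos hm (Real.exp_pos t)) hx)
    rw [Real.log_div (mul_pos hm (Real.exp_pos t)).ne' hx.ne',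
      Real.log_mul hm.ne' (Real.exp_pos t).ne', Real.log_exp] at h1
    have h2 := mul_le_mul_of_nonneg_left h1 hx.le
    rw [mul_sub, mul_sub, mul_add, mul_div_cancel₀ _ hx.ne'] at h2
    rw [Real.log_div hx.ne' hm.ne']
    linarith

theorem mul_log_div_add_sub_pos {x m : ℝ} (hx : 0 ≤ x) (hm : 0 ≤ m) (h : m = 0 → x = 0)
    (hne : x ≠ m) : 0 < x * Real.log (x / m) + m - x := by
  rcases hm.eq_or_lt with rfl | hm
  · exact absurd (h rfl) hne
  rcases hx.eq_or_lt with rfl | hx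
  · simpa using hm
  · have h1 := Real.log_lt_sub_one_of_pos (div_pos hm hx)
      fun h => hne ((div_eq_one_iff_eq hx.ne').1 h).symm
    rw [Real.log_div hm.ne' hx.ne'] at h1
    have h2 := mul_lt_mul_of_pos_left h1 hx
    rw [mul_sub, mul_sub, mul_div_cancel₀ _ hx.ne'] at h2
    rw [Real.log_div hx.ne' hm.ne']
    linarith

/-- The maximiser is `t = log (x / m)`. For `x = 0 < m` the supremum is only approached as `t → -∞`,
and `t = log (ε / m)` loses exactly `ε`. -/
theorem exists_mul_sub_mul_exp_sub_one_ge {x m : ℝ} (hx : 0 ≤ x) (hm : 0 ≤ m)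
    (h : m = 0 → x = 0) {ε : ℝ} (hε : 0 < ε) :
    ∃ t : ℝ, x * Real.log (x / m) + m - x - ε ≤ x * t - m * (Real.exp t - 1) := by
  rcases hm.eq_or_lt with rfl | hm
  · exact ⟨0, by simp [h rfl, hε.le]⟩
  rcases hx.eq_or_lt with rfl | hx
  · refine ⟨Real.log (ε / m), ?_⟩
    rw [Real.exp_log (div_pos hε hm), mul_sub, mul_div_cancel₀ _ hm.ne']
    simp
  · refine ⟨Real.log (x / m), ?_⟩
    rw [Real.exp_log (div_pos hx hm), mul_sub, mul_div_cancel₀ _ hm.ne']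
    linarith

end ScalarEntropy

/-! ### Entropy excess of finite measures -/

section RelEntropy

variable {Y : Type*} [Fintype Y] [MeasurableSpace Y] {ρ ν : Measure Y}

theorem relEntropy_add_sub_of_not_ac (h : ¬ρ ≪ ν) :
    relEntropy ρ ν + (ν.real Set.univ : EReal) - (ρ.real Set.univ : EReal) = ⊤ := by
  rw [relEntropy, if_neg h, EReal.top_add_coe, EReal.top_sub_coe]

variable [IsFiniteMeasure ρ] [IsFiniteMeasure ν]

theorem absolutelyContinuous_iff_measureReal_singleton :
    ρ ≪ ν ↔ ∀ y, ν.real {y} = 0 → ρ.real {y} = 0 := by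
  simp only [measureReal_def, ENNReal.toReal_eq_zero_iff, measure_ne_top, or_false]
  refine ⟨fun h y hy => h hy, fun h s hs => ?_⟩
  rw [← Set.biUnion_of_singleton s, measure_biUnion_null_iff (Set.to_countable s)]
  exact fun y hy => h y (measure_mono_null (Set.singleton_subset_iff.2 hy) hs)

variable [MeasurableSingletonClass Y]

/-- The entropy excess `H(ρ ‖ ν) + ‖ν‖ - ‖ρ‖` as a sum of nonnegative real numbers. -/
theorem relEntropy_add_sub_of_ac (h : ρ ≪ ν) :
    relEntropy ρ ν + (ν.real Set.univ : EReal) - (ρ.real Set.univ : EReal)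
      = ((∑ y, (ρ.real {y} * Real.log (ρ.real {y} / ν.real {y}) + ν.real {y} - ρ.real {y}) : ℝ) :
        EReal) := by
  rw [relEntropy, if_pos h, Finset.sum_sub_distrib, Finset.sum_add_distrib,
    sum_measureReal_singleton, sum_measureReal_singleton, Finset.coe_univ]
  norm_cast

theorem coe_sum_sub_le_relEntropy_add_sub (g : Y → ℝ) :
    ((∑ y, ρ.real {y} * g y - ∑ y, ν.real {y} * (Real.exp (g y) - 1) : ℝ) : EReal)
      ≤ relEntropy ρ ν + (ν.real Set.univ : EReal) - (ρ.real Set.univ : EReal) := by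
  by_cases h : ρ ≪ ν
  · rw [relEntropy_add_sub_of_ac h, ← Finset.sum_sub_distrib, EReal.coe_le_coe_iff]
    rw [absolutelyContinuous_iff_measureReal_singleton] at h
    exact Finset.sum_le_sum fun y _ =>
      mul_sub_mul_exp_sub_one_le measureReal_nonneg measureReal_nonneg (h y) _
  · rw [relEntropy_add_sub_of_not_ac h]
    exact le_top

/-- Near-optimal functions in the variational formula may be chosen as functions of the two
densities, so that they inherit their symmetries. -/
theorem exists_lt_sum_sub_of_lt_relEntropy {α : ℝ} (hα : (α : EReal) <
      relEntropy ρ ν + (ν.real Set.univ : EReal) - (ρ.real Set.univ : EReal)) :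
    ∃ τ : ℝ → ℝ → ℝ, α < ∑ y, ρ.real {y} * τ (ρ.real {y}) (ν.real {y})
      - ∑ y, ν.real {y} * (Real.exp (τ (ρ.real {y}) (ν.real {y})) - 1) := by
  by_cases h : ρ ≪ ν
  · rw [relEntropy_add_sub_of_ac h, EReal.coe_lt_coe_iff] at hα
    rw [absolutelyContinuous_iff_measureReal_singleton] at h
    set T := ∑ y, (ρ.real {y} * Real.log (ρ.real {y} / ν.real {y}) + ν.real {y} - ρ.real {y})
      with hT
    -- The `+ 1` keeps the total loss over all points strictly below `T - α`, also when `Y` is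
    -- empty.
    set ε := (T - α) / (Fintype.card Y + 1) with hε
    have hε0 : 0 < ε := div_pos (sub_pos.2 hα) (by positivity)
    have hτ : ∀ x m : ℝ, ∃ t : ℝ, 0 ≤ x → 0 ≤ m → (m = 0 → x = 0) →
        x * Real.log (x / m) + m - x - ε ≤ x * t - m * (Real.exp t - 1) := by
      intro x m
      by_cases h' : 0 ≤ x ∧ 0 ≤ m ∧ (m = 0 → x = 0)
      · obtain ⟨t, ht⟩ := exists_mul_sub_mul_exp_sub_one_ge h'.1 h'.2.1 h'.2.2 hε0
        exact ⟨t, fun _ _ _ => ht⟩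
      · exact ⟨0, fun h1 h2 h3 => absurd ⟨h1, h2, h3⟩ h'⟩
    choose τ hτ using hτ
    refine ⟨τ, ?_⟩
    have h1 := Finset.sum_le_sum fun y (_ : y ∈ Finset.univ) =>
      hτ (ρ.real {y}) (ν.real {y}) measureReal_nonneg measureReal_nonneg (h y)
    rw [Finset.sum_sub_distrib, ← hT, Finset.sum_sub_distrib, Finset.sum_const,
      Finset.card_univ, nsmul_eq_mul] at h1
    have h2 : Fintype.card Y * ε < T - α := by
      have h3 : ε * (Fintype.card Y + 1) = T - α := div_mul_cancel₀ _ (by positivity)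
      linarith
    linarith
  · rw [absolutelyContinuous_iff_measureReal_singleton] at h
    push Not at h
    obtain ⟨y, hy, hy'⟩ := h
    have hpos : 0 < ρ.real {y} := lt_of_le_of_ne measureReal_nonneg hy'.symm
    -- Raising the test function on `ν`-null points costs nothing, and this height already gains
    -- `|α| + 1` at `y`.
    set t := (|α| + 1) / ρ.real {y} with ht
    have ht0 : 0 ≤ t := by positivity
    refine ⟨fun _ m => if m = 0 then t else 0, ?_⟩
    have h1 : ∑ z, ν.real {z} * (Real.exp (if ν.real {z} = 0 then t else 0) - 1) = 0 :=
      Finset.sum_eq_zero fun z _ => by split_ifs with hz <;> simp [hz]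
    have h2 : ρ.real {y} * (if ν.real {y} = 0 then t else 0)
        ≤ ∑ z, ρ.real {z} * (if ν.real {z} = 0 then t else 0) :=
      Finset.single_le_sum (f := fun z => ρ.real {z} * (if ν.real {z} = 0 then t else 0))
        (fun z _ => mul_nonneg measureReal_nonneg (by split_ifs <;> simp [ht0]))
        (Finset.mem_univ y)
    rw [if_pos hy, ht, mul_div_cancel₀ _ hpos.ne'] at h2
    rw [h1]
    linarith [le_abs_self α]

theorem relEntropy_add_sub_pos (hne : ρ ≠ ν) :
    0 < relEntropy ρ ν + (ν.real Set.univ : EReal) - (ρ.real Set.univ : EReal) := by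
  by_cases h : ρ ≪ ν
  · rw [relEntropy_add_sub_of_ac h, ← EReal.coe_zero, EReal.coe_lt_coe_iff]
    rw [absolutelyContinuous_iff_measureReal_singleton] at h
    have h1 : ∃ y, ρ.real {y} ≠ ν.real {y} := by
      by_contra! h2
      exact hne (measure_ext_real_singleton h2)
    obtain ⟨y, hy⟩ := h1
    refine Finset.sum_pos' (fun z _ => ?_)
      ⟨y, Finset.mem_univ y, mul_log_div_add_sub_pos measureReal_nonneg measureReal_nonneg
        (h y) hy⟩
    -- Young's inequality at `t = 0` says that each summand is nonnegative.
    simpa using mul_sub_mul_exp_sub_one_le measureReal_nonneg measureReal_nonneg (h z) 0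
  · rw [relEntropy_add_sub_of_not_ac h]
    exact EReal.zero_lt_top

end RelEntropy

/-! ### Entropy of the colour law -/

section ProbabilityEntropy

variable {X : Type*} [Fintype X] [MeasurableSpace X] {μ : ProbabilityMeasure X}

theorem relEntropy_eq_of_fullSupport (hμ : ∀ c, 0 < (μ : Measure X).real {c})
    (ω : ProbabilityMeasure X) : relEntropy (ω : Measure X) (μ : Measure X)
      = ((∑ b, (ω : Measure X).real {b} *
        Real.log ((ω : Measure X).real {b} / (μ : Measure X).real {b}) : ℝ) : EReal) := by
  rw [relEntropy, if_pos]
  exact absolutelyContinuous_iff_measureReal_singleton.2 fun y hy => absurd hy (hμ y).ne'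

variable [MeasurableSingletonClass X]

/-- Every probability measure on a finite space is a limit of measures of full support, as soon as
there is one of full support. -/
theorem exists_fullSupport_approx (μ ω : ProbabilityMeasure X)
    (hμ : ∀ c, 0 < (μ : Measure X).real {c}) :
    ∃ ν : ℕ → ProbabilityMeasure X, (∀ k b, 0 < (ν k : Measure X).real {b}) ∧
      ∀ b, Tendsto (fun k => (ν k : Measure X).real {b}) atTop
        (𝓝 ((ω : Measure X).real {b})) := by
  set δ : ℕ → ℝ := fun k => 1 / ((k : ℝ) + 1) with hδ
  have hδ0 (k : ℕ) : 0 < δ k := Nat.one_div_pos_of_nat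
  have hδ1 (k : ℕ) : δ k ≤ 1 := by
    rw [hδ, div_le_one (by positivity)]
    linarith [Nat.cast_nonneg (α := ℝ) k]
  set w : ℕ → X → ℝ := fun k b =>
    (1 - δ k) * (ω : Measure X).real {b} + δ k * (μ : Measure X).real {b} with hw
  have hw0 (k : ℕ) (b : X) : 0 < w k b :=
    add_pos_of_nonneg_of_pos (mul_nonneg (sub_nonneg.2 (hδ1 k)) measureReal_nonneg)
      (mul_pos (hδ0 k) (hμ b))
  have hw1 (k : ℕ) : ∑ b, w k b = 1 := by
    simp only [hw]
    rw [Finset.sum_add_distrib, ← Finset.mul_sum, ← Finset.mul_sum, sum_measureReal_singleton,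
      sum_measureReal_singleton, Finset.coe_univ, probReal_univ, probReal_univ]
    ring
  refine ⟨fun k => ⟨pointMassMeasure (w k),
    isProbabilityMeasure_pointMassMeasure (fun b => (hw0 k b).le) (hw1 k)⟩, fun k b => ?_,
    fun b => ?_⟩
  · change 0 < (pointMassMeasure (w k)).real {b}
    rw [pointMassMeasure_real_singleton fun b => (hw0 k b).le]
    exact hw0 k b
  · change Tendsto (fun k => (pointMassMeasure (w k)).real {b}) _ _
    have h1 (k : ℕ) : (pointMassMeasure (w k)).real {b} = w k b :=
      pointMassMeasure_real_singleton (fun b => (hw0 k b).le) b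
    simp only [h1]
    have h2 : Tendsto δ atTop (𝓝 0) := tendsto_one_div_add_atTop_nhds_zero_nat
    have h3 := ((h2.const_sub 1).mul_const ((ω : Measure X).real {b})).add
      (h2.mul_const ((μ : Measure X).real {b}))
    rw [sub_zero, one_mul, zero_mul, add_zero] at h3
    exact h3

theorem relEntropy_pos (hμ : ∀ c, 0 < (μ : Measure X).real {c}) {ω : ProbabilityMeasure X}
    (hne : ω ≠ μ) : 0 < relEntropy (ω : Measure X) (μ : Measure X) := by
  have h := relEntropy_add_sub_pos (ρ := (ω : Measure X)) (ν := (μ : Measure X))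
    fun h => hne (Subtype.ext h)
  rw [relEntropy_eq_of_fullSupport hμ, probReal_univ, probReal_univ] at h
  rw [relEntropy_eq_of_fullSupport hμ]
  norm_cast at h ⊢
  linarith

namespace ColouredGraph

/-- Young's inequality is used with `t = log (μ' / μ)` at each colour; the leftover masses cancel
because all the measures are probabilities. -/
theorem colourFunctional_le_relEntropy (hμ : ∀ c, 0 < (μ : Measure X).real {c})
    {μ' : ProbabilityMeasure X} (hμ' : ∀ c, 0 < (μ' : Measure X).real {c})
    (s : ProbabilityMeasure X × SymmetricFiniteMeasure X) :
    (colourFunctional μ μ' s : EReal) ≤ relEntropy (s.1 : Measure X) (μ : Measure X) := by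
  rw [relEntropy_eq_of_fullSupport hμ, EReal.coe_le_coe_iff, colourFunctional]
  have h1 (b : X) : (s.1 : Measure X).real {b} *
      Real.log ((μ' : Measure X).real {b} / (μ : Measure X).real {b})
      ≤ (s.1 : Measure X).real {b} *
        Real.log ((s.1 : Measure X).real {b} / (μ : Measure X).real {b})
        + ((μ' : Measure X).real {b} - (s.1 : Measure X).real {b}) := by
    have h2 := mul_sub_mul_exp_sub_one_le (x := (s.1 : Measure X).real {b}) measureReal_nonneg
      (hμ b).le (fun h => absurd h (hμ b).ne')
      (Real.log ((μ' : Measure X).real {b} / (μ : Measure X).real {b}))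
    rw [Real.exp_log (div_pos (hμ' b) (hμ b)), mul_sub _ _ (1 : ℝ),
      mul_div_cancel₀ _ (hμ b).ne'] at h2
    linarith
  refine (Finset.sum_le_sum fun b _ => h1 b).trans_eq ?_
  rw [Finset.sum_add_distrib, Finset.sum_sub_distrib, sum_measureReal_singleton,
    sum_measureReal_singleton, Finset.coe_univ, probReal_univ, probReal_univ, sub_self, add_zero]

/-- The optimal `μ'` is `s.1` itself, which may lack full support; measures of full support
converging to it suffice, since colours of zero mass contribute nothing. -/
theorem exists_lt_colourFunctional (hμ : ∀ c, 0 < (μ : Measure X).real {c})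
    (s : ProbabilityMeasure X × SymmetricFiniteMeasure X) {α : ℝ}
    (hα : (α : EReal) < relEntropy (s.1 : Measure X) (μ : Measure X)) :
    ∃ μ' : ProbabilityMeasure X, (∀ c, 0 < (μ' : Measure X).real {c}) ∧
      α < colourFunctional μ μ' s := by
  obtain ⟨ν, hν, hlim⟩ := exists_fullSupport_approx μ s.1 hμ
  rw [relEntropy_eq_of_fullSupport hμ, EReal.coe_lt_coe_iff] at hα
  have h1 : Tendsto (fun k => colourFunctional μ (ν k) s) atTop
      (𝓝 (∑ b, (s.1 : Measure X).real {b} *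
        Real.log ((s.1 : Measure X).real {b} / (μ : Measure X).real {b}))) := by
    refine tendsto_finsetSum _ fun b _ => ?_
    rcases eq_or_ne ((s.1 : Measure X).real {b}) 0 with h | h
    · simp only [h, zero_mul]
      exact tendsto_const_nhds
    · exact (((hlim b).div_const _).log (div_ne_zero h (hμ b).ne')).const_mul _
  obtain ⟨k, hk⟩ := (h1.eventually_const_lt hα).exists
  exact ⟨ν k, hν k, hk⟩

end ColouredGraph

end ProbabilityEntropy

/-! # The two rate functions -/

namespace ColouredGraph

section RateFunctions

variable {X : Type*} {C : X → X → ℝ≥0}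

/-- The limiting connection intensity after tilting by `exp g`. -/
def tiltIntensity (C : X → X → ℝ≥0) (g : X × X → ℝ) : X → X → ℝ≥0 := fun b c =>
  C b c * Real.toNNReal (Real.exp (g (b, c)))

theorem coe_tiltIntensity (C : X → X → ℝ≥0) (g : X × X → ℝ) (b c : X) :
    (tiltIntensity C g b c : ℝ) = C b c * Real.exp (g (b, c)) := by
  rw [tiltIntensity, NNReal.coe_mul, Real.coe_toNNReal _ (Real.exp_pos _).le]

theorem tiltIntensity_symm (hC : ∀ b c, C b c = C c b) {g : X × X → ℝ}
    (hg : ∀ z, g z.swap = g z) (b c : X) : tiltIntensity C g b c = tiltIntensity C g c b := by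
  rw [tiltIntensity, tiltIntensity, hC b c, ← hg (b, c), Prod.swap_prod_mk]

variable [Fintype X] [MeasurableSpace X]

theorem rateI1_of_not_ac {s : ProbabilityMeasure X × SymmetricFiniteMeasure X}
    (h : ¬(s.2.1 : Measure (X × X)) ≪ tiltedProd C s.1) : rateI1 C s = ⊤ := by
  rw [rateI1, frakH, relEntropy_add_sub_of_not_ac h, EReal.coe_mul_top_of_pos one_half_pos]

/-- Each summand is a mass times `g - (exp g - 1) ≤ 0`. Hence arbitrary positive multiples of edge
functionals stay below `rateI2` where that rate is finite. -/
theorem edgeFunctional_nonpos {s : ProbabilityMeasure X × SymmetricFiniteMeasure X}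
    (h : (s.2.1 : Measure (X × X)) = tiltedProd C s.1) (g : X × X → ℝ) :
    edgeFunctional C g s ≤ 0 := by
  rw [edgeFunctional, h, ← Finset.sum_sub_distrib]
  refine mul_nonpos_of_nonneg_of_nonpos one_half_pos.le (Finset.sum_nonpos fun z _ => ?_)
  rw [← mul_sub]
  exact mul_nonpos_of_nonneg_of_nonpos measureReal_nonneg
    (by linarith [Real.add_one_le_exp (g z)])

variable [MeasurableSingletonClass X]

theorem tiltedProd_real_singleton_swap (hC : ∀ b c, C b c = C c b) (ω : ProbabilityMeasure X)
    (z : X × X) : (tiltedProd C ω).real {z.swap} = (tiltedProd C ω).real {z} := by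
  rw [tiltedProd_real_singleton, tiltedProd_real_singleton, Prod.fst_swap, Prod.snd_swap,
    hC z.2 z.1, mul_comm ((ω : Measure X).real {z.2})]

/-- The pair `(μ, Cμ ⊗ μ)` around which the empirical measures concentrate. -/
def typicalState (C : X → X → ℝ≥0) (hC : ∀ b c, C b c = C c b) (μ : ProbabilityMeasure X) :
    ProbabilityMeasure X × SymmetricFiniteMeasure X :=
  (μ, symmetricPointMassMeasure (fun z => (tiltedProd C μ).real {z})
    (tiltedProd_real_singleton_swap hC μ))

theorem typicalState_snd (hC : ∀ b c, C b c = C c b) (μ : ProbabilityMeasure X) :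
    ((typicalState C hC μ).2.1 : Measure (X × X)) = tiltedProd C μ := by
  change pointMassMeasure (fun z => (tiltedProd C μ).real {z}) = tiltedProd C μ
  exact measure_ext_real_singleton fun z =>
    pointMassMeasure_real_singleton (fun _ => measureReal_nonneg) z

theorem eq_typicalState (hC : ∀ b c, C b c = C c b) {μ : ProbabilityMeasure X}
    {s : ProbabilityMeasure X × SymmetricFiniteMeasure X} (h1 : s.1 = μ)
    (h2 : (s.2.1 : Measure (X × X)) = tiltedProd C s.1) : s = typicalState C hC μ := by
  refine Prod.ext h1 (Subtype.ext (Subtype.ext ?_))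
  rw [h1, ← typicalState_snd hC] at h2
  exact h2

theorem rateI1_of_ac {s : ProbabilityMeasure X × SymmetricFiniteMeasure X}
    (h : (s.2.1 : Measure (X × X)) ≪ tiltedProd C s.1) :
    rateI1 C s = ((1 / 2 * ∑ z, ((s.2.1 : Measure (X × X)).real {z} *
      Real.log ((s.2.1 : Measure (X × X)).real {z} / (tiltedProd C s.1).real {z})
        + (tiltedProd C s.1).real {z} - (s.2.1 : Measure (X × X)).real {z}) : ℝ) : EReal) := by
  rw [rateI1, frakH, relEntropy_add_sub_of_ac h, EReal.coe_mul]

theorem edgeFunctional_le_rateI1 (g : X × X → ℝ)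
    (s : ProbabilityMeasure X × SymmetricFiniteMeasure X) :
    (edgeFunctional C g s : EReal) ≤ rateI1 C s := by
  rw [edgeFunctional, rateI1, EReal.coe_mul]
  exact mul_le_mul_of_nonneg_left (coe_sum_sub_le_relEntropy_add_sub g)
    (by exact_mod_cast one_half_pos.le)

/-- Only symmetric `g` tilt the model. A near-optimal `g` that is a function of the two point masses
is symmetric because both masses are invariant under the swap. -/
theorem exists_lt_edgeFunctional (hC : ∀ b c, C b c = C c b)
    (s : ProbabilityMeasure X × SymmetricFiniteMeasure X) {α : ℝ}
    (hα : (α : EReal) < rateI1 C s) :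
    ∃ g : X × X → ℝ, (∀ z, g z.swap = g z) ∧ α < edgeFunctional C g s := by
  have h1 : ((2 * α : ℝ) : EReal) < frakH C s.2 s.1 := by
    by_cases h : (s.2.1 : Measure (X × X)) ≪ tiltedProd C s.1
    · rw [rateI1_of_ac h, EReal.coe_lt_coe_iff] at hα
      rw [frakH, relEntropy_add_sub_of_ac h, EReal.coe_lt_coe_iff]
      linarith
    · rw [frakH, relEntropy_add_sub_of_not_ac h]
      exact EReal.coe_lt_top _
  obtain ⟨τ, hτ⟩ := exists_lt_sum_sub_of_lt_relEntropy h1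
  refine ⟨fun z => τ ((s.2.1 : Measure (X × X)).real {z}) ((tiltedProd C s.1).real {z}),
    fun z => ?_, ?_⟩
  · simp only [SymmetricFiniteMeasure.real_singleton_swap, tiltedProd_real_singleton_swap hC]
  · rw [edgeFunctional]
    linarith

theorem rateI1_pos {s : ProbabilityMeasure X × SymmetricFiniteMeasure X}
    (hne : (s.2.1 : Measure (X × X)) ≠ tiltedProd C s.1) : 0 < rateI1 C s := by
  rw [rateI1]
  exact EReal.mul_pos (by exact_mod_cast one_half_pos) (relEntropy_add_sub_pos hne)

theorem rateI2_pos (hC : ∀ b c, C b c = C c b) {μ : ProbabilityMeasure X}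
    (hμ : ∀ c, 0 < (μ : Measure X).real {c})
    {s : ProbabilityMeasure X × SymmetricFiniteMeasure X} (hs : s ≠ typicalState C hC μ) :
    0 < rateI2 μ C s := by
  rw [rateI2]
  split_ifs with h
  · exact relEntropy_pos hμ fun h' => hs (eq_typicalState hC h' h)
  · exact EReal.zero_lt_top

end RateFunctions

/-! ### Continuity, compact level sets and approximation by typical states -/

section Topology

variable {X : Type*} [Fintype X] [TopologicalSpace X] [DiscreteTopology X] [MeasurableSpace X]
  [BorelSpace X] {C : X → X → ℝ≥0}

theorem continuous_colourFunctional (μ μ' : ProbabilityMeasure X) :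
    Continuous (colourFunctional μ μ') :=
  continuous_finsetSum _ fun b _ =>
    ((ProbabilityMeasure.continuous_measureReal_singleton b).comp continuous_fst).mul_const _

theorem continuous_edgeFunctional (C : X → X → ℝ≥0) (g : X × X → ℝ) :
    Continuous (edgeFunctional C g) := by
  have h1 (b : X) : Continuous fun s : ProbabilityMeasure X × SymmetricFiniteMeasure X =>
      (s.1 : Measure X).real {b} :=
    (ProbabilityMeasure.continuous_measureReal_singleton b).comp continuous_fst
  have h2 (z : X × X) : Continuous fun s : ProbabilityMeasure X × SymmetricFiniteMeasure X =>
      (s.2.1 : Measure (X × X)).real {z} :=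
    (FiniteMeasure.continuous_measureReal_singleton z).comp
      (continuous_subtype_val.comp continuous_snd)
  unfold edgeFunctional
  simp only [tiltedProd_real_singleton]
  exact ((continuous_finsetSum _ fun z _ => (h2 z).mul_const _).sub
    (continuous_finsetSum _ fun z _ =>
      (continuous_const.mul ((h1 z.1).mul (h1 z.2))).mul_const _)).const_mul _

/-- For constant `g` the functional controls the total mass of `ϖ`, since the mass of `Cω ⊗ ω` is at
most the sum of all `C b c`. -/
theorem isCompact_setOf_edgeFunctional_one_le (C : X → X → ℝ≥0) (α : ℝ) :
    IsCompact {s | edgeFunctional C (fun _ => 1) s ≤ α} := by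
  refine (isCompact_setOf_measureReal_univ_le
    (2 * α + (∑ z : X × X, (C z.1 z.2 : ℝ)) * (Real.exp 1 - 1))).of_isClosed_subset
    (isClosed_le (continuous_edgeFunctional C _) continuous_const) fun s hs => ?_
  change edgeFunctional C _ s ≤ α at hs
  rw [edgeFunctional, ← Finset.sum_mul, ← Finset.sum_mul,
    sum_measureReal_singleton, Finset.coe_univ, mul_one] at hs
  have h1 : ∑ z, (tiltedProd C s.1).real {z} ≤ ∑ z : X × X, (C z.1 z.2 : ℝ) := by
    refine Finset.sum_le_sum fun z _ => ?_
    rw [tiltedProd_real_singleton]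
    exact mul_le_of_le_one_right (NNReal.coe_nonneg _)
      (mul_le_one₀ measureReal_le_one measureReal_nonneg measureReal_le_one)
  have h2 : 0 ≤ Real.exp 1 - 1 := by linarith [Real.add_one_le_exp (1 : ℝ)]
  have h3 := mul_le_mul_of_nonneg_right h1 h2
  change (s.2.1 : Measure (X × X)).real Set.univ ≤ _
  linarith

/-- Points of finite rate `rateI1` are approximated, together with their rates, by typical states
of tilted models. -/
theorem exists_typicalState_tilt_approx (hC : ∀ b c, C b c = C c b) {μ : ProbabilityMeasure X}
    (hμ : ∀ c, 0 < (μ : Measure X).real {c})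
    {O : Set (ProbabilityMeasure X × SymmetricFiniteMeasure X)} (hO : IsOpen O)
    {s : ProbabilityMeasure X × SymmetricFiniteMeasure X} (hs : s ∈ O) {β : ℝ}
    (hβ : rateI1 C s < β) :
    ∃ μ' : ProbabilityMeasure X, (∀ c, 0 < (μ' : Measure X).real {c}) ∧
      ∃ (g : X × X → ℝ) (hg : ∀ z, g z.swap = g z),
        typicalState (tiltIntensity C g) (tiltIntensity_symm hC hg) μ' ∈ O ∧
        edgeFunctional C g (typicalState (tiltIntensity C g) (tiltIntensity_symm hC hg) μ')
          < β := by
  by_cases hac : (s.2.1 : Measure (X × X)) ≪ tiltedProd C s.1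
  swap
  · rw [rateI1_of_not_ac hac] at hβ
    exact absurd hβ not_top_lt
  rw [rateI1_of_ac hac, EReal.coe_lt_coe_iff] at hβ
  rw [absolutelyContinuous_iff_measureReal_singleton] at hac
  set w : X × X → ℝ := fun z => (s.2.1 : Measure (X × X)).real {z} with hw
  set m : X × X → ℝ := fun z => (tiltedProd C s.1).real {z} with hm
  set h : X × X → ℝ := fun z => w z / m z with hh
  have hh0 (z : X × X) : 0 ≤ h z := div_nonneg measureReal_nonneg measureReal_nonneg
  have hhm (z : X × X) : m z * h z = w z := by
    rcases eq_or_ne (m z) 0 with h0 | h0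
    · rw [h0, zero_mul]
      exact (hac z h0).symm
    · exact mul_div_cancel₀ _ h0
  obtain ⟨ν, hν, hlim⟩ := exists_fullSupport_approx μ s.1 hμ
  set δ : ℕ → ℝ := fun k => 1 / ((k : ℝ) + 1) with hδ
  have hδ0 (k : ℕ) : 0 < δ k := Nat.one_div_pos_of_nat
  have hδlim : Tendsto δ atTop (𝓝 0) := tendsto_one_div_add_atTop_nhds_zero_nat
  have hpos (k : ℕ) (z : X × X) : 0 < h z + δ k := add_pos_of_nonneg_of_pos (hh0 z) (hδ0 k)
  -- The ideal tilt is `log h`, with `h` the density of `ϖ` with respect to `Cω ⊗ ω`; the shift by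
  -- `δ k` keeps it meaningful where `h = 0`.
  set g : ℕ → X × X → ℝ := fun k z => Real.log (h z + δ k) with hg
  have hexp (k : ℕ) (z : X × X) : Real.exp (g k z) = h z + δ k := Real.exp_log (hpos k z)
  have hgs (k : ℕ) (z : X × X) : g k z.swap = g k z := by
    simp only [hg, hh, hw, hm, SymmetricFiniteMeasure.real_singleton_swap,
      tiltedProd_real_singleton_swap hC]
  set t : ℕ → ProbabilityMeasure X × SymmetricFiniteMeasure X := fun k =>
    typicalState (tiltIntensity C (g k)) (tiltIntensity_symm hC (hgs k)) (ν k) with ht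
  set N : ℕ → X × X → ℝ := fun k z => (tiltedProd C (ν k)).real {z} with hN
  have hNlim (z : X × X) : Tendsto (fun k => N k z) atTop (𝓝 (m z)) := by
    simp only [hN, hm, tiltedProd_real_singleton]
    exact ((hlim z.1).mul (hlim z.2)).const_mul _
  have ht2 (k : ℕ) (z : X × X) :
      ((t k).2.1 : Measure (X × X)).real {z} = N k z * (h z + δ k) := by
    simp only [ht, hN]
    rw [typicalState_snd, tiltedProd_real_singleton, tiltedProd_real_singleton,
      coe_tiltIntensity, hexp]
    ring
  have hshift (z : X × X) : Tendsto (fun k => h z + δ k) atTop (𝓝 (h z)) := by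
    simpa using hδlim.const_add (h z)
  have htlim : Tendsto t atTop (𝓝 s) := by
    refine tendsto_state hlim fun z => ?_
    simp only [ht2]
    have := (hNlim z).mul (hshift z)
    rw [hhm] at this
    exact this
  have hval : Tendsto (fun k => edgeFunctional C (g k) (t k)) atTop
      (𝓝 (1 / 2 * ∑ z, (w z * Real.log (w z / m z) + m z - w z))) := by
    have h1 : ∑ z, (w z * Real.log (w z / m z) + m z - w z)
        = ∑ z, m z * (h z * Real.log (h z)) - ∑ z, m z * (h z - 1) := by
      rw [← Finset.sum_sub_distrib]
      refine Finset.sum_congr rfl fun z _ => ?_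
      rw [← mul_assoc, mul_sub, hhm]
      ring
    rw [h1]
    simp only [edgeFunctional, ht2, hexp]
    refine ((tendsto_finsetSum _ fun z _ => ?_).sub
      (tendsto_finsetSum _ fun z _ => (hNlim z).mul ((hshift z).sub_const 1))).const_mul _
    simp only [mul_assoc]
    -- Continuity of `x * log x` also at 0 covers the points where the density vanishes.
    exact (hNlim z).mul ((Real.continuous_mul_log.tendsto (h z)).comp (hshift z))
  obtain ⟨k, hk1, hk2⟩ :=
    ((htlim.eventually (hO.mem_nhds hs)).and (hval.eventually_lt_const hβ)).exists
  exact ⟨ν k, hν k, g k, hgs k, hk1, hk2⟩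

/-- Points of finite rate `rateI2` are approximated, together with their rates, by typical states
of models with a different colour law. -/
theorem exists_typicalState_approx (hC : ∀ b c, C b c = C c b) {μ : ProbabilityMeasure X}
    (hμ : ∀ c, 0 < (μ : Measure X).real {c})
    {O : Set (ProbabilityMeasure X × SymmetricFiniteMeasure X)} (hO : IsOpen O)
    {s : ProbabilityMeasure X × SymmetricFiniteMeasure X} (hs : s ∈ O) {β : ℝ}
    (hβ : rateI2 μ C s < β) :
    ∃ μ' : ProbabilityMeasure X, (∀ c, 0 < (μ' : Measure X).real {c}) ∧
      typicalState C hC μ' ∈ O ∧ colourFunctional μ μ' (typicalState C hC μ') < β := by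
  rw [rateI2] at hβ
  split_ifs at hβ with h
  swap
  · exact absurd hβ not_top_lt
  rw [relEntropy_eq_of_fullSupport hμ, EReal.coe_lt_coe_iff] at hβ
  obtain ⟨ν, hν, hlim⟩ := exists_fullSupport_approx μ s.1 hμ
  have htlim : Tendsto (fun k => typicalState C hC (ν k)) atTop (𝓝 s) := by
    refine tendsto_state hlim fun z => ?_
    simp only [typicalState_snd, h, tiltedProd_real_singleton]
    exact ((hlim z.1).mul (hlim z.2)).const_mul _
  have hval : Tendsto (fun k => colourFunctional μ (ν k) (typicalState C hC (ν k))) atTop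
      (𝓝 (∑ b, (s.1 : Measure X).real {b} *
        Real.log ((s.1 : Measure X).real {b} / (μ : Measure X).real {b}))) := by
    refine tendsto_finsetSum _ fun b _ => ?_
    -- In this form continuity of `y * log y` applies even if `s.1` gives no mass to `b`.
    have h1 (x : ℝ) : x * Real.log (x / (μ : Measure X).real {b}) = (μ : Measure X).real {b} *
        (x / (μ : Measure X).real {b} * Real.log (x / (μ : Measure X).real {b})) := by
      rw [← mul_assoc, mul_div_cancel₀ _ (hμ b).ne']
    change Tendsto (fun k => (ν k : Measure X).real {b} *
      Real.log ((ν k : Measure X).real {b} / (μ : Measure X).real {b})) _ _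
    rw [h1]
    refine Tendsto.congr (fun k => (h1 _).symm) ?_
    exact ((Real.continuous_mul_log.tendsto _).comp ((hlim b).div_const _)).const_mul _
  obtain ⟨k, hk1, hk2⟩ :=
    ((htlim.eventually (hO.mem_nhds hs)).and (hval.eventually_lt_const hβ)).exists
  exact ⟨ν k, hν k, hk1, hk2⟩

end Topology

end ColouredGraph

/-! # Large deviations of the empirical measures of sparse coloured random graphs -/

namespace ColouredGraph

/-- The connection probabilities `p n` are symmetric and asymptotic to `a n • C`, where `a n → 0`
and `n * a n → ∞`. -/
structure IsSparseLimit {X : Type*} (p : ℕ+ → X → X → unitInterval) (a : ℕ+ → ℝ)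
    (C : X → X → ℝ≥0) : Prop where
  symm : ∀ n b c, p n b c = p n c b
  pos : ∀ n, 0 < a n
  tendsto_zero : Tendsto a atTop (𝓝 0)
  tendsto_mul : Tendsto (fun n : ℕ+ => (n : ℝ) * a n) atTop atTop
  limit_symm : ∀ b c, C b c = C c b
  tendsto_limit : ∀ b c, Tendsto (fun n => (a n)⁻¹ * (p n b c : ℝ)) atTop (𝓝 (C b c : ℝ))

/-- The pair of the empirical colour measure and the empirical pair measure. -/
def empirical {X : Type*} [MeasurableSpace X] (a : ℕ+ → ℝ) (n : ℕ+) (x : ColouredGraph X n) :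
    ProbabilityMeasure X × SymmetricFiniteMeasure X := (x.L1, x.L2 (a n))

theorem tendsto_pnat_cast_atTop : Tendsto (fun n : ℕ+ => (n : ℝ)) atTop atTop :=
  tendsto_natCast_atTop_atTop.comp tendsto_PNat_val_atTop_atTop

/-- Lower bounds for the probabilities of events that are likely under another law, if the density
of that law is bounded on them. -/
theorem eventually_exp_le_of_comparison {X : Type*} [Fintype X] [MeasurableSpace X]
    [MeasurableSingletonClass X] {μ μ' : ProbabilityMeasure X}
    {p p' : ℕ+ → X → X → unitInterval} {r : ℕ+ → ℝ} (hr : Tendsto r atTop atTop)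
    {A B : ∀ n : ℕ+, Set (ColouredGraph X n)} (hAB : ∀ n, A n ⊆ B n) {γ β : ℝ} (hγ : γ < β)
    (hhalf : ∀ᶠ n : ℕ+ in atTop, 1 / 2 ≤ (law n μ' (p' n)).real (A n))
    (hw : ∀ᶠ n : ℕ+ in atTop, ∀ x ∈ A n,
      weight μ' (p' n) x ≤ Real.exp (r n * γ) * weight μ (p n) x) :
    ∀ᶠ n : ℕ+ in atTop, Real.exp (-(r n * β)) ≤ (law n μ (p n)).real (B n) := by
  filter_upwards [hhalf, hw, hr.eventually_ge_atTop (1 / (β - γ))] with n h1 h2 h3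
  -- The gap between `γ` and `β` pays for the probability being only `1 / 2`.
  have h4 : 2 ≤ Real.exp (r n * (β - γ)) := by
    rw [div_le_iff₀ (sub_pos.2 hγ)] at h3
    linarith [Real.add_one_le_exp (r n * (β - γ))]
  have h5 := h1.trans (law_real_le_mul μ' μ (p' n) (p n) h2)
  calc Real.exp (-(r n * β)) = Real.exp (-(r n * γ)) * (Real.exp (r n * (β - γ)))⁻¹ := by
        rw [← Real.exp_neg, ← Real.exp_add]
        ring_nf
    _ ≤ Real.exp (-(r n * γ)) * 2⁻¹ := by gcongr
    _ ≤ Real.exp (-(r n * γ)) * (Real.exp (r n * γ) * (law n μ (p n)).real (A n)) := by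
        rw [one_div] at h5
        gcongr
    _ = (law n μ (p n)).real (A n) := by
        rw [← mul_assoc, ← Real.exp_add, neg_add_cancel, Real.exp_zero, one_mul]
    _ ≤ (law n μ (p n)).real (B n) := measureReal_mono (hAB n)

namespace IsSparseLimit

/-! ### Stability under tilting and comparison of the speeds -/

section Speed

variable {X : Type*} {p : ℕ+ → X → X → unitInterval} {a : ℕ+ → ℝ} {C : X → X → ℝ≥0}

theorem tilt (h : IsSparseLimit p a C) {g : X × X → ℝ} (hg : ∀ z, g z.swap = g z) :
    IsSparseLimit (fun n => tilt (p n) g) a (tiltIntensity C g) where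
  symm n b c := by
    apply Subtype.ext
    have : g (b, c) = g (c, b) := hg (c, b)
    rw [coe_tilt, coe_tilt, h.symm n b c, this]
  pos := h.pos
  tendsto_zero := h.tendsto_zero
  tendsto_mul := h.tendsto_mul
  limit_symm := tiltIntensity_symm h.limit_symm hg
  tendsto_limit b c := by
    rw [coe_tiltIntensity]
    exact tendsto_tilt h.pos h.tendsto_zero h.tendsto_limit g b c

theorem speed_pos (h : IsSparseLimit p a C) (n : ℕ+) : 0 < a n * (n : ℝ) ^ 2 := by
  have := h.pos n
  have hn : (0 : ℝ) < n := by exact_mod_cast n.pos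
  positivity

theorem eventually_mul_le_speed (h : IsSparseLimit p a C) (K : ℝ) :
    ∀ᶠ n : ℕ+ in atTop, (n : ℝ) * K ≤ a n * (n : ℝ) ^ 2 := by
  filter_upwards [h.tendsto_mul.eventually_ge_atTop K] with n hn
  have h1 : (0 : ℝ) ≤ n := Nat.cast_nonneg _
  calc (n : ℝ) * K ≤ n * (n * a n) := mul_le_mul_of_nonneg_left hn h1
    _ = a n * (n : ℝ) ^ 2 := by ring

theorem tendsto_speed (h : IsSparseLimit p a C) :
    Tendsto (fun n : ℕ+ => a n * (n : ℝ) ^ 2) atTop atTop := by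
  refine tendsto_atTop_mono' _ (h.eventually_mul_le_speed 1) ?_
  simpa using tendsto_pnat_cast_atTop

end Speed

variable {X : Type*} [Fintype X] [MeasurableSpace X] [MeasurableSingletonClass X]
  {p : ℕ+ → X → X → unitInterval} {a : ℕ+ → ℝ} {C : X → X → ℝ≥0}

/-- A Chernoff bound: on this event the tilted law has density at least `exp (a n * n ^ 2 * (α -
e))` for large `n`, while its total mass is at most one. -/
theorem expSmall_edgeFunctional (h : IsSparseLimit p a C) (μ : ProbabilityMeasure X)
    {g : X × X → ℝ} (hg : ∀ z, g z.swap = g z) (α : ℝ) :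
    ExpSmall (fun n : ℕ+ => law n μ (p n)) (empirical a) (fun n => a n * (n : ℝ) ^ 2) α
      {s | α < edgeFunctional C g s} := by
  obtain ⟨ε, hε, hw⟩ := exists_weight_tilt_error h.symm h.pos h.tendsto_zero h.limit_symm
    h.tendsto_limit hg
  intro e he
  filter_upwards [hε.eventually_le_const he] with n hn
  refine (law_real_le_mul μ μ (p n) (ColouredGraph.tilt (p n) g)
    (κ := Real.exp (-(a n * (n : ℝ) ^ 2 * (α - e)))) fun x hx => ?_).trans
    (mul_le_of_le_one_right (Real.exp_pos _).le measureReal_le_one)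
  obtain ⟨η, hη, hx'⟩ := hw μ n x
  rw [hx', mul_left_comm, ← Real.exp_add]
  refine le_mul_of_one_le_right (weight_nonneg _ _ _) (Real.one_le_exp ?_)
  have h1 : α < edgeFunctional C g (x.L1, x.L2 (a n)) := hx
  have h2 := (abs_le.1 (hη.trans hn)).1
  have h3 := mul_nonneg (h.speed_pos n).le
    (by linarith : 0 ≤ edgeFunctional C g (x.L1, x.L2 (a n)) + η - (α - e))
  linarith

theorem expSmall_colourFunctional (p : ℕ+ → X → X → unitInterval) (a : ℕ+ → ℝ)
    {μ μ' : ProbabilityMeasure X} (hμ : ∀ c, 0 < (μ : Measure X).real {c})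
    (hμ' : ∀ c, 0 < (μ' : Measure X).real {c}) (α : ℝ) :
    ExpSmall (fun n : ℕ+ => law n μ (p n)) (empirical a) (fun n => (n : ℝ)) α
      {s | α < colourFunctional μ μ' s} := by
  intro e he
  refine Eventually.of_forall fun n => ?_
  refine (law_real_le_mul μ μ' (p n) (p n)
    (κ := Real.exp (-((n : ℝ) * (α - e)))) fun x hx => ?_).trans
    (mul_le_of_le_one_right (Real.exp_pos _).le measureReal_le_one)
  rw [weight_colour_tilt_eq μ μ' hμ hμ' (p n) (a n) x, mul_left_comm, ← Real.exp_add]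
  refine le_mul_of_one_le_right (weight_nonneg _ _ _) (Real.one_le_exp ?_)
  have h1 : α < colourFunctional μ μ' (x.L1, x.L2 (a n)) := hx
  have h3 := mul_nonneg (Nat.cast_nonneg (α := ℝ) n)
    (by linarith : 0 ≤ colourFunctional μ μ' (x.L1, x.L2 (a n)) - (α - e))
  linarith

/-- On the scale `n`, which is much smaller than `a n * n ^ 2`, positive values of `edgeFunctional`
are superexponentially unlikely. -/
theorem expSmall_const_mul_edgeFunctional (h : IsSparseLimit p a C) (μ : ProbabilityMeasure X)
    {g : X × X → ℝ} (hg : ∀ z, g z.swap = g z) {K : ℝ} (hK : 0 < K) (α : ℝ) :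
    ExpSmall (fun n : ℕ+ => law n μ (p n)) (empirical a) (fun n => (n : ℝ)) α
      {s | α < K * edgeFunctional C g s} := by
  intro e he
  rcases le_or_gt α 0 with hα | hα
  · refine Eventually.of_forall fun n => measureReal_le_one.trans (Real.one_le_exp ?_)
    have := mul_nonneg (Nat.cast_nonneg (α := ℝ) n) (by linarith : 0 ≤ e - α)
    linarith
  · have hβ : 0 < α / K := div_pos hα hK
    -- Half of the exponent `α / K` is spent as slack; the remaining half, at a speed of at least `2
    -- * K * n`, still yields `n * α`.
    filter_upwards [h.expSmall_edgeFunctional μ hg (α / K) (α / K / 2) (half_pos hβ),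
      h.eventually_mul_le_speed (2 * K)] with n h1 h2
    have hset : {s | α < K * edgeFunctional C g s} = {s | α / K < edgeFunctional C g s} := by
      ext s
      exact (div_lt_iff₀' hK).symm
    rw [hset]
    refine h1.trans (Real.exp_le_exp.2 (neg_le_neg ?_))
    have h3 := mul_le_mul_of_nonneg_right h2 (half_pos hβ).le
    have h4 : (n : ℝ) * (2 * K) * (α / K / 2) = n * α := by field_simp
    have h5 := mul_nonneg (Nat.cast_nonneg (α := ℝ) n) he.le
    rw [h4] at h3
    linarith

variable [TopologicalSpace X] [DiscreteTopology X] [BorelSpace X]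

theorem isTailFamily_edge (h : IsSparseLimit p a C) (μ : ProbabilityMeasure X) :
    IsTailFamily (fun n : ℕ+ => law n μ (p n)) (empirical a) (fun n => a n * (n : ℝ) ^ 2)
      (rateI1 C) {Φ | ∃ g : X × X → ℝ, (∀ z, g z.swap = g z) ∧ Φ = edgeFunctional C g} where
  continuous := by
    rintro _ ⟨g, _, rfl⟩
    exact continuous_edgeFunctional C g
  expSmall := by
    rintro _ ⟨g, hg, rfl⟩ α
    exact h.expSmall_edgeFunctional μ hg α
  le := by
    rintro _ ⟨g, _, rfl⟩ s
    exact edgeFunctional_le_rateI1 g s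
  exists_lt s α hα := by
    obtain ⟨g, hg, hlt⟩ := exists_lt_edgeFunctional h.limit_symm s hα
    exact ⟨_, ⟨g, hg, rfl⟩, hlt⟩
  zero_mem := ⟨fun _ => 0, fun _ => rfl, by ext s; simp [edgeFunctional]⟩
  exists_isCompact := ⟨_, ⟨fun _ => 1, fun _ => rfl, rfl⟩,
    isCompact_setOf_edgeFunctional_one_le C⟩

/-- Colour functionals recover the entropy where `ϖ = Cω ⊗ ω`. Elsewhere some edge functional is
positive, and its multiples are unbounded. -/
theorem isTailFamily_colour (h : IsSparseLimit p a C) {μ : ProbabilityMeasure X}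
    (hμ : ∀ c, 0 < (μ : Measure X).real {c}) :
    IsTailFamily (fun n : ℕ+ => law n μ (p n)) (empirical a) (fun n => (n : ℝ)) (rateI2 μ C)
      ({Φ | ∃ μ' : ProbabilityMeasure X, (∀ c, 0 < (μ' : Measure X).real {c}) ∧
          Φ = colourFunctional μ μ'} ∪
        {Φ | ∃ K > 0, ∃ g : X × X → ℝ, (∀ z, g z.swap = g z) ∧
          Φ = fun s => K * edgeFunctional C g s}) where
  continuous := by
    rintro _ (⟨μ', _, rfl⟩ | ⟨K, _, g, _, rfl⟩)
    · exact continuous_colourFunctional μ μ'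
    · exact (continuous_edgeFunctional C g).const_mul K
  expSmall := by
    rintro _ (⟨μ', hμ', rfl⟩ | ⟨K, hK, g, hg, rfl⟩) α
    · exact expSmall_colourFunctional p a hμ hμ' α
    · exact h.expSmall_const_mul_edgeFunctional μ hg hK α
  le := by
    rintro _ (⟨μ', hμ', rfl⟩ | ⟨K, hK, g, hg, rfl⟩) s
    · rw [rateI2]
      split_ifs
      · exact colourFunctional_le_relEntropy hμ hμ' s
      · exact le_top
    · rw [rateI2]
      split_ifs with hs
      · have h1 := colourFunctional_le_relEntropy hμ hμ s
        have h2 : colourFunctional μ μ s = 0 :=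
          Finset.sum_eq_zero fun b _ => by rw [div_self (hμ b).ne', Real.log_one, mul_zero]
        rw [h2] at h1
        refine le_trans ?_ h1
        exact_mod_cast mul_nonpos_of_nonneg_of_nonpos hK.le (edgeFunctional_nonpos hs g)
      · exact le_top
  exists_lt s α hα := by
    rw [rateI2] at hα
    split_ifs at hα with hs
    · obtain ⟨μ', hμ', hlt⟩ := exists_lt_colourFunctional hμ s hα
      exact ⟨_, Or.inl ⟨μ', hμ', rfl⟩, hlt⟩
    · obtain ⟨g, hg, hlt⟩ := exists_lt_edgeFunctional h.limit_symm s
        (α := 0) (by simpa using rateI1_pos hs)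
      refine ⟨_, Or.inr ⟨(|α| + 1) / edgeFunctional C g s, by positivity, g, hg, rfl⟩, ?_⟩
      rw [div_mul_cancel₀ _ hlt.ne']
      linarith [le_abs_self α]
  zero_mem := Or.inr ⟨1, one_pos, fun _ => 0, fun _ => rfl, by ext s; simp [edgeFunctional]⟩
  exists_isCompact := by
    refine ⟨_, Or.inr ⟨1, one_pos, fun _ => 1, fun _ => rfl, rfl⟩, fun α => ?_⟩
    simpa using isCompact_setOf_edgeFunctional_one_le C α

/-- The law of large numbers for the empirical measures. -/
theorem eventually_half_le (h : IsSparseLimit p a C) {μ : ProbabilityMeasure X}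
    (hμ : ∀ c, 0 < (μ : Measure X).real {c})
    {U : Set (ProbabilityMeasure X × SymmetricFiniteMeasure X)} (hU : IsOpen U)
    (hmem : typicalState C h.limit_symm μ ∈ U) :
    ∀ᶠ n : ℕ+ in atTop, 1 / 2 ≤ (law n μ (p n)).real (empirical a n ⁻¹' U) := by
  have h1 := (h.isTailFamily_colour hμ).tendsto_zero_of_isClosed tendsto_pnat_cast_atTop
    hU.isClosed_compl fun s hs => rateI2_pos h.limit_symm hμ fun h' => hs (h' ▸ hmem)
  filter_upwards [h1.eventually_le_const one_half_pos] with n hn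
  rw [Set.preimage_compl, probReal_compl_eq_one_sub MeasurableSet.of_discrete] at hn
  linarith

/-- The lower bound at a typical state of a tilted model, on the scale `a n * n ^ 2`. -/
theorem eventually_exp_le_edge (h : IsSparseLimit p a C) {μ μ' : ProbabilityMeasure X}
    (hμ : ∀ c, 0 < (μ : Measure X).real {c}) (hμ' : ∀ c, 0 < (μ' : Measure X).real {c})
    {g : X × X → ℝ} (hg : ∀ z, g z.swap = g z)
    {O : Set (ProbabilityMeasure X × SymmetricFiniteMeasure X)} (hO : IsOpen O)
    (hmem : typicalState (tiltIntensity C g) (tiltIntensity_symm h.limit_symm hg) μ' ∈ O) {β : ℝ}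
    (hβ : edgeFunctional C g
      (typicalState (tiltIntensity C g) (tiltIntensity_symm h.limit_symm hg) μ') < β) :
    ∀ᶠ n : ℕ+ in atTop, Real.exp (-(a n * (n : ℝ) ^ 2 * β))
      ≤ (law n μ (p n)).real (empirical a n ⁻¹' O) := by
  obtain ⟨γ, h1, h2⟩ := exists_between hβ
  -- One `e` is for the error in the edge density and one for the change of colour law; `γ + 2 * e`
  -- remains below `β`.
  set e := (β - γ) / 4 with he
  have he0 : 0 < e := by linarith
  obtain ⟨ε, hε, hw⟩ := exists_weight_tilt_error h.symm h.pos h.tendsto_zero h.limit_symm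
    h.tendsto_limit hg
  refine eventually_exp_le_of_comparison h.tendsto_speed (γ := γ + 2 * e)
    (A := fun n => empirical a n ⁻¹' (O ∩ {s | edgeFunctional C g s < γ}))
    (fun n => Set.preimage_mono Set.inter_subset_left) (by linarith)
    ((h.tilt hg).eventually_half_le hμ' (hO.inter
      (isOpen_lt (continuous_edgeFunctional C g) continuous_const)) ⟨hmem, h1⟩) ?_
  -- This bounds the colour exponent per vertex uniformly, so changing the colour law costs at most
  -- `n * K`, negligible at this speed.
  set K := ∑ b, |Real.log ((μ' : Measure X).real {b} / (μ : Measure X).real {b})| with hK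
  filter_upwards [hε.eventually_le_const he0, h.eventually_mul_le_speed (K / e)] with n h3 h4 x hx
  obtain ⟨η, hη, hx'⟩ := hw μ' n x
  rw [hx', weight_colour_tilt_eq μ μ' hμ hμ' (p n) (a n) x, mul_assoc, ← Real.exp_add, mul_comm]
  refine mul_le_mul_of_nonneg_right (Real.exp_le_exp.2 ?_) (weight_nonneg _ _ _)
  have h5 : colourFunctional μ μ' (x.L1, x.L2 (a n)) ≤ K := by
    refine Finset.sum_le_sum fun b _ => (le_abs_self _).trans ?_
    rw [abs_mul, abs_of_nonneg measureReal_nonneg]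
    exact mul_le_of_le_one_left (abs_nonneg _) measureReal_le_one
  have h6 := mul_le_mul_of_nonneg_left h5 (Nat.cast_nonneg (α := ℝ) n)
  have h7 : (n : ℝ) * K ≤ a n * (n : ℝ) ^ 2 * e := by
    rwa [← mul_div_assoc, div_le_iff₀ he0] at h4
  have h8 : edgeFunctional C g (x.L1, x.L2 (a n)) < γ := hx.2
  have h9 := mul_le_mul_of_nonneg_left
    (by linarith [(abs_le.1 (hη.trans h3)).2] :
      edgeFunctional C g (x.L1, x.L2 (a n)) + η ≤ γ + e) (h.speed_pos n).le
  linarith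

/-- The lower bound at a typical state of a model with a different colour law, on the scale `n`. -/
theorem eventually_exp_le_colour (h : IsSparseLimit p a C) {μ μ' : ProbabilityMeasure X}
    (hμ : ∀ c, 0 < (μ : Measure X).real {c}) (hμ' : ∀ c, 0 < (μ' : Measure X).real {c})
    {O : Set (ProbabilityMeasure X × SymmetricFiniteMeasure X)} (hO : IsOpen O)
    (hmem : typicalState C h.limit_symm μ' ∈ O) {β : ℝ}
    (hβ : colourFunctional μ μ' (typicalState C h.limit_symm μ') < β) :
    ∀ᶠ n : ℕ+ in atTop, Real.exp (-((n : ℝ) * β))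
      ≤ (law n μ (p n)).real (empirical a n ⁻¹' O) := by
  obtain ⟨γ, h1, h2⟩ := exists_between hβ
  refine eventually_exp_le_of_comparison tendsto_pnat_cast_atTop (γ := γ)
    (A := fun n => empirical a n ⁻¹' (O ∩ {s | colourFunctional μ μ' s < γ}))
    (fun n => Set.preimage_mono Set.inter_subset_left) h2
    (h.eventually_half_le hμ' (hO.inter
      (isOpen_lt (continuous_colourFunctional μ μ') continuous_const)) ⟨hmem, h1⟩)
    (Eventually.of_forall fun n x hx => ?_)
  rw [weight_colour_tilt_eq μ μ' hμ hμ' (p n) (a n) x, mul_comm]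
  refine mul_le_mul_of_nonneg_right (Real.exp_le_exp.2 ?_) (weight_nonneg _ _ _)
  have h8 : colourFunctional μ μ' (x.L1, x.L2 (a n)) < γ := hx.2
  exact mul_le_mul_of_nonneg_left h8.le (Nat.cast_nonneg _)

theorem satisfiesLDP_edge (h : IsSparseLimit p a C) {μ : ProbabilityMeasure X}
    (hμ : ∀ c, 0 < (μ : Measure X).real {c}) :
    SatisfiesLDP (fun n : ℕ+ => law n μ (p n)) (empirical a) (fun n => a n * (n : ℝ) ^ 2)
      (rateI1 C) := by
  refine (h.isTailFamily_edge μ).satisfiesLDP h.speed_pos h.tendsto_speed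
    fun O hO s hs β hβ => ?_
  obtain ⟨μ', hμ', g, hg, hmem, hlt⟩ := exists_typicalState_tilt_approx h.limit_symm hμ hO hs hβ
  exact h.eventually_exp_le_edge hμ hμ' hg hO hmem hlt

theorem satisfiesLDP_colour (h : IsSparseLimit p a C) {μ : ProbabilityMeasure X}
    (hμ : ∀ c, 0 < (μ : Measure X).real {c}) :
    SatisfiesLDP (fun n : ℕ+ => law n μ (p n)) (empirical a) (fun n => (n : ℝ))
      (rateI2 μ C) := by
  refine (h.isTailFamily_colour hμ).satisfiesLDP (fun n => by exact_mod_cast n.pos)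
    tendsto_pnat_cast_atTop fun O hO s hs β hβ => ?_
  obtain ⟨μ', hμ', hmem, hlt⟩ := exists_typicalState_approx h.limit_symm hμ hO hs hβ
  exact h.eventually_exp_le_colour hμ hμ' hO hmem hlt

end IsSparseLimit

end ColouredGraph

end

theorem theorem3p3 {X : Type*} [Fintype X] [TopologicalSpace X] [DiscreteTopology X]
    [MeasurableSpace X] [BorelSpace X]
    (μ : ProbabilityMeasure X) (hμ : ∀ c : X, 0 < μ {c})
    (p : ℕ+ → X → X → unitInterval) (hp : ∀ n b c, p n b c = p n c b)
    (a : ℕ+ → ℝ) (ha : ∀ n, 0 < a n) (ha_zero : Tendsto a atTop (𝓝 0))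
    (hna : Tendsto (fun n : ℕ+ => (n : ℝ) * a n) atTop atTop)
    (C : X → X → ℝ≥0) (hC : ∀ b c, C b c = C c b)
    (hpC : ∀ b c, Tendsto (fun n => (a n)⁻¹ * (p n b c : ℝ)) atTop (𝓝 (C b c : ℝ))) :
    SatisfiesLDP (fun n : ℕ+ => ColouredGraph.law n μ (p n))
        (fun n x => (x.L1, x.L2 (a n))) (fun n => a n * (n : ℝ) ^ 2) (rateI1 C) ∧
      SatisfiesLDP (fun n : ℕ+ => ColouredGraph.law n μ (p n))
        (fun n x => (x.L1, x.L2 (a n))) (fun n => (n : ℝ)) (rateI2 μ C) := by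
  have h : ColouredGraph.IsSparseLimit p a C := ⟨hp, ha, ha_zero, hna, hC, hpC⟩
  have hμ' (c : X) : 0 < (μ : Measure X).real {c} := by
    rw [ProbabilityMeasure.measureReal_eq_coe_coeFn]
    exact_mod_cast hμ c
  exact ⟨h.satisfiesLDP_edge hμ', h.satisfiesLDP_colour hμ'⟩
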